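/- Let $K$ be a quadratic number field, let $\sigma$ be the nontrivial automorphism of $K$, and fix an algebraic closure $\overline K$ of $K$. For an elliptic curve $E/K$, write $E^\sigma$ for its Galois conjugate. An $N$-isogeny over $K$ is an isogeny of elliptic curves defined over $K$ whose kernel (in the $\overline K$-points) is cyclic of order $N$. Let $m,n,k$ be positive integers such that $2^k$ divides $n$. Suppose that for every elliptic curve $E/K$ and every $2^{m-1}n$-isogeny $\psi\colon E\to E_1$ defined over $K$ there is an $n$-isogeny $\varphi\colon E\to E_2$ defined over $K$ such that $E_2$ is isomorphic to $E^\sigma$ over $\overline K$ and $$\#(\ker\varphi\cap\ker\psi)=\frac{n}{2^k}.$$ Then every elliptic curve $E/K$ that has a $2^m n$-isogeny defined over $K$ has complex multiplication, that is, $\operatorname{End}_{\overline K}(E)\neq\mathbb Z$. -/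

import Mathlib

section IsogenyDefs

/-- Let `F ⊆ Ω` be fields of characteristic zero with `Ω` algebraically closed, and let `W`, `W'` be
elliptic curves over `Ω`. A homomorphism of groups `φ : W(Ω) → W'(Ω)` is an isogeny defined over `F`
if it is given by rational functions with coefficients in `F`, that is, if there are polynomials
`p, q, r, s ∈ F[X, Y]` such that, for all but finitely many points `P ∈ W(Ω)`, the point `P = (x, y)`
is affine, `q(x, y)` and `s(x, y)` are nonzero, and `φ(P)` is the affine point
`(p(x, y) / q(x, y), r(x, y) / s(x, y))`.

A homomorphism that agrees with a rational map off a finite set is regular everywhere (use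
translations), so this describes exactly the morphisms over `F` that respect the group structure.
As `W(Ω)` is infinite and `φ(P) ≠ 0` off a finite set, the zero map is excluded and the kernel is
finite. In characteristic zero every isogeny is separable, so its degree is the cardinality of its
kernel. -/
def IsIsogenyOver (F : Type*) {Ω : Type*} [Field F] [Field Ω] [Algebra F Ω] [DecidableEq Ω]
    {W W' : WeierstrassCurve.Affine Ω} (φ : W.Point →+ W'.Point) : Prop :=
  ∃ p q r s : MvPolynomial (Fin 2) F,
    {P : W.Point | ¬ ∃ (x y : Ω) (h : W.Nonsingular x y),
      P = .some x y h ∧ MvPolynomial.aeval ![x, y] q ≠ 0 ∧ MvPolynomial.aeval ![x, y] s ≠ 0 ∧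
      ∃ h' : W'.Nonsingular
          (MvPolynomial.aeval ![x, y] p / MvPolynomial.aeval ![x, y] q)
          (MvPolynomial.aeval ![x, y] r / MvPolynomial.aeval ![x, y] s),
        φ P = .some _ _ h'}.Finite

/-- An `N`-isogeny defined over `F`: an isogeny over `F` whose kernel (on geometric points) is a
cyclic group of order `N`. -/
def IsCyclicIsogenyOver (F : Type*) {Ω : Type*} [Field F] [Field Ω] [Algebra F Ω] [DecidableEq Ω]
    (N : ℕ) {W W' : WeierstrassCurve.Affine Ω} (φ : W.Point →+ W'.Point) : Prop :=
  IsIsogenyOver F φ ∧ IsAddCyclic φ.ker ∧ Nat.card φ.ker = N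

variable {K : Type*} [Field K]

/-- The base change of a curve over `K` to the algebraic closure of `K`. -/
noncomputable abbrev geomCurve (E : WeierstrassCurve K) :
    WeierstrassCurve.Affine (AlgebraicClosure K) :=
  WeierstrassCurve.baseChange E (AlgebraicClosure K)

/-- `E'` is a twist of `E`: the two curves over `K` become isomorphic over the algebraic closure. -/
def IsTwist (E E' : WeierstrassCurve K) : Prop :=
  ∃ C : WeierstrassCurve.VariableChange (AlgebraicClosure K), C • geomCurve E = geomCurve E'

open scoped Classical in
/-- The elliptic curve `E` over `K` has an `N`-isogeny defined over `K`. -/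
def HasCyclicIsogeny (E : WeierstrassCurve K) (N : ℕ) : Prop :=
  ∃ (E' : WeierstrassCurve K) (_ : E'.IsElliptic)
    (φ : (geomCurve E).Point →+ (geomCurve E').Point), IsCyclicIsogenyOver K N φ

open scoped Classical in
/-- The elliptic curve `E` has complex multiplication: over the algebraic closure it has an
endomorphism which is not multiplication by an integer. -/
def HasCM (E : WeierstrassCurve K) : Prop :=
  ∃ φ : (geomCurve E).Point →+ (geomCurve E).Point,
    IsIsogenyOver (AlgebraicClosure K) φ ∧ ∀ z : ℤ, ∃ P, φ P ≠ z • P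

end IsogenyDefs

/-!
Suppose that `E` has no complex multiplication and let `C` be the cyclic kernel of the given
isogeny of degree `2 ^ m * n`. Its point `c` of order two is rational, which gives a `2`-isogeny
`π : E → E'` over `K` with kernel `{0, c}` and a dual `π'`. The subgroups `2 C` of `E` and `C / c`
of `E'` are kernels of cyclic isogenies of degree `2 ^ (m - 1) * n` over `K`
(`exists_half_isogenies`), so the hypothesis applies to both and yields cyclic `n`-isogenies `φ`
from `E` and `φ'` from `E'` to the conjugate curves, up to twists.

An extension of `σ` to the algebraic closure identifies the geometric points of `E` with those of
its conjugate. This turns `φ` and `φ'` into semilinear endomorphisms `Φ` and `Φ'` of the groups of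
points of `E` and `E'`. Since `σ ∘ σ = 1`, the composites `Φ ∘ Φ` and `Φ ∘ π' ∘ Φ' ∘ π` become,
after one automorphism `g` of the group of points, endomorphisms of the curve `E`, hence
multiplications by integers. Comparing them on the `2`-power torsion, where the kernels of `Φ` and
`Φ'` are cyclic of the same order, shows that `π` intertwines `Φ` and `Φ'` there up to odd
integers (`exists_odd_intertwining`).

This contradicts the sizes of `ker Φ ∩ 2 C` and `ker Φ' ∩ C / c`, both `n / 2 ^ k`
(`not_scalar_of_card_inter`). If `n / 2 ^ k` is odd, then `c` lies in `2 C` but not in `ker Φ`,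
and the intertwining gives `Φ c = c`; but `Φ ∘ Φ` is an even integer up to `g` and kills `c`. If
`n / 2 ^ k` is even, then `c` lies in `ker Φ`, the `2`-part of `ker Φ'` contains the image of that
of `ker Φ`, and lifting the intersection of `ker Φ'` with `C / c` along `π` makes `ker Φ ∩ 2 C`
too large.

The geometric input is elementary. Isogenies are homomorphisms with rational coordinates
(`isIsogenyOver_iff`), and additivity has to be checked only generically
(`addMonoidHomOfGeneric`). The quotient by a rational point of order two is the classical
`2`-isogeny of `y² = x³ + a x² + b x` (`exists_twoIsogeny`); isogenies that kill this point factor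
through the quotient over `K`, because functions descend along it by averaging over the
translation by `(0, 0)` (`isRatFun_of_comp_twoIsog`).
-/

namespace WeierstrassCurve.Affine

open Filter

/-! ### Homomorphisms determined off a finite set -/

section Generic

/-- A map between abelian groups is additive as soon as, for every `P`, additivity holds for all but
finitely many `Q`: compare `f (P + Q + R)` for a generic `R`. -/
def addMonoidHomOfGeneric {G H : Type*} [AddCommGroup G] [AddCommGroup H] [Infinite G] (f : G → H)
    (hf : ∀ P, ∀ᶠ Q in cofinite, f (P + Q) = f P + f Q) : G →+ H :=
  AddMonoidHom.mk' f fun P Q ↦ by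
    have hQ : Tendsto (Q + ·) cofinite cofinite := (add_right_injective Q).tendsto_cofinite
    obtain ⟨R, h₁, h₂, h₃⟩ := ((hf (P + Q)).and ((hQ.eventually (hf P)).and (hf Q))).exists
    rw [add_assoc, h₂, h₃, ← add_assoc] at h₁
    exact (add_right_cancel h₁).symm

/-- Two homomorphisms on an infinite group that agree off a finite set are equal. -/
lemma eq_of_eventuallyEq {G H : Type*} [AddCommGroup G] [AddCommGroup H] [Infinite G]
    {f g : G →+ H} (h : f =ᶠ[cofinite] g) : f = g := by
  ext P
  have hP : Tendsto (P + ·) cofinite cofinite := (add_right_injective P).tendsto_cofinite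
  obtain ⟨R, h₁, h₂⟩ := (h.and (hP.eventually h)).exists
  simpa [h₁] using h₂

lemma tendsto_cofinite_of_finite_ker {G H : Type*} [AddCommGroup G] [AddCommGroup H]
    {f : G →+ H} (h : (f.ker : Set G).Finite) : Tendsto f cofinite cofinite := by
  refine Tendsto.cofinite_of_finite_preimage_singleton fun b ↦ ?_
  by_cases hb : ∃ P, f P = b
  · obtain ⟨P, rfl⟩ := hb
    refine (h.image (P + ·)).subset fun Q hQ ↦ ⟨Q - P, ?_, by simp⟩
    have : f Q = f P := hQ
    simp [AddMonoidHom.mem_ker, this]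
  · refine Set.finite_empty.subset fun Q hQ ↦ hb ⟨Q, hQ⟩

end Generic

/-! ### Coordinates of points -/

section Coordinates

variable {Ω : Type*} [Field Ω] {W : Affine Ω}

/-- The `x`-coordinate of a point, with the value `0` at infinity. -/
def Point.xCoord : W.Point → Ω
  | .zero => 0
  | .some x _ _ => x

/-- The `y`-coordinate of a point, with the value `0` at infinity. -/
def Point.yCoord : W.Point → Ω
  | .zero => 0
  | .some _ y _ => y

@[simp] lemma Point.xCoord_some {x y : Ω} (h : W.Nonsingular x y) :
    Point.xCoord (.some x y h) = x := rfl

@[simp] lemma Point.yCoord_some {x y : Ω} (h : W.Nonsingular x y) :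
    Point.yCoord (.some x y h) = y := rfl

/-- The fibres of the `x`-coordinate are finite. -/
lemma eventually_xCoord_notMem (S : Set Ω) (hS : S.Finite) :
    ∀ᶠ P : W.Point in cofinite, ∃ x y, ∃ h : W.Nonsingular x y, P = .some x y h ∧ x ∉ S := by
  have key : ∀ c : Ω, {P : W.Point | ∃ y, ∃ h : W.Nonsingular c y, P = .some c y h}.Finite := by
    intro c
    by_cases hc : ∃ y, W.Nonsingular c y
    · obtain ⟨y, h⟩ := hc
      refine (Set.toFinite {Point.some c y h, -Point.some c y h}).subset ?_
      rintro _ ⟨y', h', rfl⟩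
      exact Point.X_eq_iff.mp rfl
    · refine Set.finite_empty.subset ?_
      rintro _ ⟨y', h', rfl⟩
      exact hc ⟨y', h'⟩
  rw [eventually_cofinite]
  refine ((hS.biUnion fun c _ ↦ key c).union (Set.finite_singleton (0 : W.Point))).subset ?_
  rintro (_ | ⟨x, y, h⟩) hP
  · exact Or.inr rfl
  · refine Or.inl (Set.mem_biUnion (x := x) ?_ ⟨y, h, rfl⟩)
    by_contra hx
    exact hP ⟨x, y, h, rfl, hx⟩

lemma eventually_eval_ne_zero {f : Polynomial Ω} (hf : f ≠ 0) :
    ∀ᶠ P : W.Point in cofinite, ∃ x y, ∃ h : W.Nonsingular x y, P = .some x y h ∧ f.eval x ≠ 0 := by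
  filter_upwards [eventually_xCoord_notMem (f.rootSet Ω) (Polynomial.rootSet_finite f Ω)]
  rintro P ⟨x, y, h, rfl, hx⟩
  refine ⟨x, y, h, rfl, fun h0 ↦ hx ?_⟩
  rw [Polynomial.mem_rootSet]
  exact ⟨hf, by simpa using h0⟩

lemma eventually_eq_some :
    ∀ᶠ P : W.Point in cofinite, ∃ x y, ∃ h : W.Nonsingular x y, P = .some x y h :=
  (eventually_xCoord_notMem ∅ Set.finite_empty).mono fun _ ⟨x, y, h, hP, _⟩ ↦ ⟨x, y, h, hP⟩

/-- Every `x` is the abscissa of a point of an elliptic curve over an algebraically closed field. -/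
lemma exists_equation [IsAlgClosed Ω] (W : Affine Ω) (x : Ω) : ∃ y, W.Equation x y := by
  let f : Polynomial Ω := Polynomial.X ^ 2 + Polynomial.C (W.a₁ * x + W.a₃) * Polynomial.X
    - Polynomial.C (x ^ 3 + W.a₂ * x ^ 2 + W.a₄ * x + W.a₆)
  have hf : f.degree = 2 := by
    simp only [f]
    compute_degree!
  obtain ⟨y, hy⟩ := IsAlgClosed.exists_root f (by rw [hf]; decide)
  refine ⟨y, ?_⟩
  rw [equation_iff']
  simp only [f, Polynomial.IsRoot, Polynomial.eval_sub, Polynomial.eval_add, Polynomial.eval_pow,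
    Polynomial.eval_X, Polynomial.eval_mul, Polynomial.eval_C] at hy
  linear_combination hy

instance infinite_point [IsAlgClosed Ω] [W.IsElliptic] : Infinite W.Point := by
  choose y hy using W.exists_equation
  have : Infinite Ω := IsAlgClosed.instInfinite
  refine Infinite.of_injective (fun x : Ω ↦ Point.mk (hy x)) fun a b h ↦ ?_
  simpa [Point.mk] using congr_arg Point.xCoord h

end Coordinates

/-! ### Rational functions and isogenies -/

section RatFun

variable (F : Type*) {Ω : Type*} [Field F] [Field Ω] [Algebra F Ω] {W : Affine Ω}

/-- A function on the points of `W` is rational over `F` if, off a finite set, it is given by a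
quotient of polynomials in the coordinates with coefficients in `F`. -/
def IsRatFun (f : W.Point → Ω) : Prop :=
  ∃ p q : MvPolynomial (Fin 2) F, ∀ᶠ P : W.Point in cofinite, ∃ x y, ∃ h : W.Nonsingular x y,
    P = .some x y h ∧ MvPolynomial.aeval ![x, y] q ≠ 0 ∧
      f P = MvPolynomial.aeval ![x, y] p / MvPolynomial.aeval ![x, y] q

variable {F}

namespace IsRatFun

variable {f g : W.Point → Ω}

lemma congr (hf : IsRatFun F f) (h : g =ᶠ[cofinite] f) : IsRatFun F g := by
  obtain ⟨p, q, hpq⟩ := hf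
  refine ⟨p, q, ?_⟩
  filter_upwards [hpq, h] with P hP hg
  simpa only [hg] using hP

lemma of_polynomial (p : MvPolynomial (Fin 2) F)
    (h : ∀ x y (h : W.Nonsingular x y), f (.some x y h) = MvPolynomial.aeval ![x, y] p) :
    IsRatFun F f := by
  refine ⟨p, 1, ?_⟩
  filter_upwards [eventually_eq_some]
  rintro P ⟨x, y, hxy, rfl⟩
  exact ⟨x, y, hxy, rfl, by simp, by simp [h]⟩

lemma const (c : F) : IsRatFun F fun _ : W.Point ↦ algebraMap F Ω c :=
  of_polynomial (MvPolynomial.C c) fun _ _ _ ↦ by simp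

lemma xCoord : IsRatFun F (Point.xCoord (W := W)) :=
  of_polynomial (MvPolynomial.X 0) fun _ _ _ ↦ by simp

lemma yCoord : IsRatFun F (Point.yCoord (W := W)) :=
  of_polynomial (MvPolynomial.X 1) fun _ _ _ ↦ by simp

lemma add (hf : IsRatFun F f) (hg : IsRatFun F g) : IsRatFun F fun P ↦ f P + g P := by
  obtain ⟨p, q, hpq⟩ := hf
  obtain ⟨r, s, hrs⟩ := hg
  refine ⟨p * s + q * r, q * s, ?_⟩
  filter_upwards [hpq, hrs]
  rintro P ⟨x, y, h, rfl, hq, hf⟩ ⟨x', y', h', hP, hs, hg⟩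
  obtain ⟨rfl, rfl⟩ := Point.some.inj hP
  refine ⟨x, y, h, rfl, by simp [hq, hs], ?_⟩
  simp only [hf, hg, map_add, map_mul]
  field_simp

lemma mul (hf : IsRatFun F f) (hg : IsRatFun F g) : IsRatFun F fun P ↦ f P * g P := by
  obtain ⟨p, q, hpq⟩ := hf
  obtain ⟨r, s, hrs⟩ := hg
  refine ⟨p * r, q * s, ?_⟩
  filter_upwards [hpq, hrs]
  rintro P ⟨x, y, h, rfl, hq, hf⟩ ⟨x', y', h', hP, hs, hg⟩
  obtain ⟨rfl, rfl⟩ := Point.some.inj hP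
  refine ⟨x, y, h, rfl, by simp [hq, hs], ?_⟩
  simp only [hf, hg, map_mul]
  field_simp

lemma neg (hf : IsRatFun F f) : IsRatFun F fun P ↦ - f P := by
  simpa using (const (-1)).mul hf

lemma sub (hf : IsRatFun F f) (hg : IsRatFun F g) : IsRatFun F fun P ↦ f P - g P := by
  simpa [sub_eq_add_neg] using hf.add hg.neg

lemma pow (hf : IsRatFun F f) (n : ℕ) : IsRatFun F fun P ↦ f P ^ n := by
  induction n with
  | zero => simpa using const (W := W) (1 : F)
  | succ n ih => simpa [pow_succ] using ih.mul hf

lemma div (hf : IsRatFun F f) (hg : IsRatFun F g) (h0 : ∀ᶠ P in cofinite, g P ≠ 0) :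
    IsRatFun F fun P ↦ f P / g P := by
  obtain ⟨p, q, hpq⟩ := hf
  obtain ⟨r, s, hrs⟩ := hg
  refine ⟨p * s, q * r, ?_⟩
  filter_upwards [hpq, hrs, h0]
  rintro P ⟨x, y, h, rfl, hq, hf⟩ ⟨x', y', h', hP, hs, hg⟩ hg0
  obtain ⟨rfl, rfl⟩ := Point.some.inj hP
  rw [hg] at hg0
  have hr := (div_ne_zero_iff.mp hg0).1
  refine ⟨x, y, h, rfl, by simp [hq, hr], ?_⟩
  simp only [hf, hg, map_mul]
  field_simp

lemma aeval (hf : IsRatFun F f) (hg : IsRatFun F g) (p : MvPolynomial (Fin 2) F) :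
    IsRatFun F fun P ↦ MvPolynomial.aeval ![f P, g P] p := by
  induction p using MvPolynomial.induction_on with
  | C a => simpa using const a
  | add p q hp hq => simpa using hp.add hq
  | mul_X p i hp =>
    fin_cases i
    · simpa using hp.mul hf
    · simpa using hp.mul hg

/-- A rational function over `F` is rational over every larger field of constants. -/
lemma mono (F' : Type*) [Field F'] [Algebra F F'] [Algebra F' Ω] [IsScalarTower F F' Ω]
    (hf : IsRatFun F f) : IsRatFun F' f := by
  obtain ⟨p, q, hpq⟩ := hf
  refine ⟨MvPolynomial.map (algebraMap F F') p, MvPolynomial.map (algebraMap F F') q, ?_⟩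
  simpa only [MvPolynomial.aeval_map_algebraMap] using hpq

end IsRatFun

section Isogeny

variable [DecidableEq Ω] {W' W'' : Affine Ω} {φ : W.Point →+ W'.Point} {ψ : W'.Point →+ W''.Point}

/-- An isogeny over `F` is a homomorphism with rational coordinates over `F` which is nonzero off a
finite set. -/
lemma isIsogenyOver_iff : IsIsogenyOver F φ ↔ IsRatFun F (fun P ↦ (φ P).xCoord) ∧
    IsRatFun F (fun P ↦ (φ P).yCoord) ∧ ∀ᶠ P in cofinite, φ P ≠ 0 := by
  constructor
  · rintro ⟨p, q, r, s, h⟩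
    have h' := eventually_cofinite.mpr h
    refine ⟨⟨p, q, ?_⟩, ⟨r, s, ?_⟩, ?_⟩
    · filter_upwards [h']
      rintro P ⟨x, y, h, rfl, hq, hs, _, hφ⟩
      exact ⟨x, y, h, rfl, hq, by simp [hφ]⟩
    · filter_upwards [h']
      rintro P ⟨x, y, h, rfl, hq, hs, _, hφ⟩
      exact ⟨x, y, h, rfl, hs, by simp [hφ]⟩
    · filter_upwards [h']
      rintro P ⟨x, y, h, rfl, hq, hs, _, hφ⟩
      rw [hφ]
      exact Point.some_ne_zero _
  · rintro ⟨⟨p, q, hpq⟩, ⟨r, s, hrs⟩, h0⟩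
    refine ⟨p, q, r, s, eventually_cofinite.mp ?_⟩
    filter_upwards [hpq, hrs, h0]
    rintro P ⟨x, y, h, rfl, hq, hx⟩ ⟨x', y', h', hP, hs, hy⟩ hφ
    obtain ⟨rfl, rfl⟩ := Point.some.inj hP
    refine ⟨x, y, h, rfl, hq, hs, ?_⟩
    rcases hφP : φ (.some x y h) with _ | ⟨X, Y, hXY⟩
    · exact (hφ hφP).elim
    · simp only [hφP, Point.xCoord_some, Point.yCoord_some] at hx hy
      subst hx hy
      exact ⟨hXY, rfl⟩

lemma _root_.IsIsogenyOver.finite_ker (hφ : IsIsogenyOver F φ) : (φ.ker : Set W.Point).Finite := by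
  have := (isIsogenyOver_iff.mp hφ).2.2
  rw [eventually_cofinite] at this
  exact this.subset fun P hP ↦ by simpa using hP

lemma _root_.IsIsogenyOver.tendsto (hφ : IsIsogenyOver F φ) : Tendsto φ cofinite cofinite :=
  tendsto_cofinite_of_finite_ker hφ.finite_ker

lemma IsRatFun.comp {f : W'.Point → Ω} (hf : IsRatFun F f) (hφ : IsIsogenyOver F φ) :
    IsRatFun F fun P ↦ f (φ P) := by
  obtain ⟨p, q, hpq⟩ := hf
  obtain ⟨hx, hy, -⟩ := isIsogenyOver_iff.mp hφ
  have hpq' := hφ.tendsto.eventually hpq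
  refine ((hx.aeval hy p).div (hx.aeval hy q) ?_).congr ?_
  · filter_upwards [hpq']
    rintro P ⟨x, y, h, hP, hq, -⟩
    simpa [hP] using hq
  · filter_upwards [hpq']
    rintro P ⟨x, y, h, hP, hq, hf⟩
    rw [hf]
    simp [hP]

lemma _root_.IsIsogenyOver.comp (hψ : IsIsogenyOver F ψ) (hφ : IsIsogenyOver F φ) :
    IsIsogenyOver F (ψ.comp φ) := by
  obtain ⟨hx, hy, h0⟩ := isIsogenyOver_iff.mp hψ
  exact isIsogenyOver_iff.mpr ⟨hx.comp hφ, hy.comp hφ, hφ.tendsto.eventually h0⟩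

lemma _root_.IsIsogenyOver.mono (F' : Type*) [Field F'] [Algebra F F'] [Algebra F' Ω]
    [IsScalarTower F F' Ω] (hφ : IsIsogenyOver F φ) : IsIsogenyOver F' φ := by
  obtain ⟨hx, hy, h0⟩ := isIsogenyOver_iff.mp hφ
  exact isIsogenyOver_iff.mpr ⟨hx.mono F', hy.mono F', h0⟩

end Isogeny

end RatFun

/-! ### Conjugation by field automorphisms -/

section RingEquiv

variable {Ω : Type*} [Field Ω]

lemma aeval_map_ringEquiv (e : Ω ≃+* Ω) (x y : Ω) (p : MvPolynomial (Fin 2) Ω) :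
    MvPolynomial.aeval ![e x, e y] (MvPolynomial.map (e : Ω →+* Ω) p)
      = e (MvPolynomial.aeval ![x, y] p) := by
  induction p using MvPolynomial.induction_on with
  | C a => simp
  | add p q hp hq => simp only [map_add, hp, hq]
  | mul_X p i hp =>
    simp only [map_mul, hp, MvPolynomial.map_X, MvPolynomial.aeval_X]
    fin_cases i <;> simp

variable [DecidableEq Ω]

/-- The isomorphism from the points of `W` to the points of the conjugate curve `W'` that applies an
automorphism `e` of the field to the coordinates. -/
def pointCongr (e : Ω ≃+* Ω) {W W' : Affine Ω} (h : W.map (e : Ω →+* Ω) = W') :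
    W.Point ≃+ W'.Point where
  toFun P := match P with
    | .zero => .zero
    | .some x y hxy => .some (e x) (e y) (h ▸ (map_nonsingular W e.injective x y).mpr hxy)
  invFun P := match P with
    | .zero => .zero
    | .some x y hxy => .some (e.symm x) (e.symm y) <| by
        subst h
        refine (map_nonsingular (f := (e : Ω →+* Ω)) W e.injective _ _).mp ?_
        simpa using hxy
  left_inv := by rintro (_ | _) <;> simp
  right_inv := by rintro (_ | _) <;> simp
  map_add' := by
    subst h
    rintro (_ | ⟨x₁, y₁, h₁⟩) (_ | ⟨x₂, y₂, h₂⟩)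
    any_goals rfl
    by_cases hxy : x₁ = x₂ ∧ y₁ = W.negY x₂ y₂
    · rw [Point.add_of_Y_eq hxy.1 hxy.2, Point.add_of_Y_eq (congr_arg e hxy.1)]
      · rfl
      · rw [hxy.2]
        exact (map_negY (e : Ω →+* Ω) x₂ y₂).symm
    · have hxy' : ¬ (e x₁ = e x₂ ∧ e y₁ = (W.map (e : Ω →+* Ω)).negY (e x₂) (e y₂)) := by
        rintro ⟨hx, hy⟩
        refine hxy ⟨e.injective hx, e.injective (hy.trans ?_)⟩
        exact map_negY (e : Ω →+* Ω) x₂ y₂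
      have hs := map_slope (W := W) (e : Ω →+* Ω) x₁ x₂ y₁ y₂
      have hX := map_addX (W' := W) (e : Ω →+* Ω) x₁ x₂ (W.slope x₁ x₂ y₁ y₂)
      have hY := map_addY (W' := W) (e : Ω →+* Ω) x₁ y₁ x₂ (W.slope x₁ x₂ y₁ y₂)
      rw [← hs] at hX hY
      rw [Point.add_some hxy, Point.add_some hxy', Point.some.injEq]
      exact ⟨hX.symm, hY.symm⟩

@[simp]
lemma pointCongr_some (e : Ω ≃+* Ω) {W W' : Affine Ω} (h : W.map (e : Ω →+* Ω) = W') {x y : Ω}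
    (hxy : W.Nonsingular x y) : pointCongr e h (.some x y hxy) =
      .some (e x) (e y) (h ▸ (map_nonsingular W e.injective x y).mpr hxy) := rfl

lemma xCoord_pointCongr (e : Ω ≃+* Ω) {W W' : Affine Ω} (h : W.map (e : Ω →+* Ω) = W')
    (P : W.Point) : (pointCongr e h P).xCoord = e P.xCoord := by
  cases P
  · exact (map_zero e).symm
  · rfl

lemma yCoord_pointCongr (e : Ω ≃+* Ω) {W W' : Affine Ω} (h : W.map (e : Ω →+* Ω) = W')
    (P : W.Point) : (pointCongr e h P).yCoord = e P.yCoord := by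
  cases P
  · exact (map_zero e).symm
  · rfl

variable {W₁ W₁' W₂ W₂' : Affine Ω}

lemma IsRatFun.conj (e : Ω ≃+* Ω) (h : W₁.map (e : Ω →+* Ω) = W₁') {f : W₁.Point → Ω}
    (hf : IsRatFun Ω f) : IsRatFun Ω fun P ↦ e (f ((pointCongr e h).symm P)) := by
  obtain ⟨p, q, hpq⟩ := hf
  refine ⟨MvPolynomial.map (e : Ω →+* Ω) p, MvPolynomial.map (e : Ω →+* Ω) q, ?_⟩
  filter_upwards [(pointCongr e h).symm.injective.tendsto_cofinite.eventually hpq]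
  rintro P ⟨x, y, hxy, hP, hq, hf⟩
  have hP' := (AddEquiv.symm_apply_eq _).mp hP
  refine ⟨_, _, _, hP', ?_, ?_⟩
  · rw [aeval_map_ringEquiv]
    exact (map_ne_zero e).mpr hq
  · rw [aeval_map_ringEquiv, aeval_map_ringEquiv, hf, map_div₀]

/-- The conjugate of an isogeny under a field automorphism is an isogeny. -/
lemma _root_.IsIsogenyOver.conj (e : Ω ≃+* Ω) (h₁ : W₁.map (e : Ω →+* Ω) = W₁')
    (h₂ : W₂.map (e : Ω →+* Ω) = W₂') {φ : W₁.Point →+ W₂.Point} (hφ : IsIsogenyOver Ω φ) :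
    IsIsogenyOver Ω (((pointCongr e h₂ : W₂.Point →+ W₂'.Point).comp φ).comp
      ((pointCongr e h₁).symm : W₁'.Point →+ W₁.Point)) := by
  obtain ⟨hx, hy, h0⟩ := isIsogenyOver_iff.mp hφ
  refine isIsogenyOver_iff.mpr ⟨?_, ?_, ?_⟩
  · simpa [xCoord_pointCongr] using hx.conj e h₁
  · simpa [yCoord_pointCongr] using hy.conj e h₁
  · filter_upwards [(pointCongr e h₁).symm.injective.tendsto_cofinite.eventually h0] with P hP
    simpa using hP

/-- An isogeny over `F` commutes with the automorphisms over `F`. -/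
lemma _root_.IsIsogenyOver.map_pointCongr {F : Type*} [Field F] [Algebra F Ω] [Infinite W₁.Point]
    {φ : W₁.Point →+ W₂.Point} (hφ : IsIsogenyOver F φ) (τ : Ω ≃ₐ[F] Ω)
    (h₁ : W₁.map ((τ : Ω ≃+* Ω) : Ω →+* Ω) = W₁) (h₂ : W₂.map ((τ : Ω ≃+* Ω) : Ω →+* Ω) = W₂)
    (P : W₁.Point) :
    φ (pointCongr (τ : Ω ≃+* Ω) h₁ P) = pointCongr (τ : Ω ≃+* Ω) h₂ (φ P) := by
  suffices φ.comp (pointCongr (τ : Ω ≃+* Ω) h₁ : W₁.Point →+ W₁.Point)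
      = (pointCongr (τ : Ω ≃+* Ω) h₂ : W₂.Point →+ W₂.Point).comp φ from DFunLike.congr_fun this P
  have hτ : ∀ (x y : Ω) (p : MvPolynomial (Fin 2) F),
      MvPolynomial.aeval ![τ x, τ y] p = τ (MvPolynomial.aeval ![x, y] p) := by
    intro x y p
    induction p using MvPolynomial.induction_on with
    | C a => simp
    | add p q hp hq => simp only [map_add, hp, hq]
    | mul_X p i hp =>
      simp only [map_mul, hp, MvPolynomial.aeval_X]
      fin_cases i <;> simp
  obtain ⟨p, q, r, s, h⟩ := hφ
  have h' := eventually_cofinite.mpr h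
  refine eq_of_eventuallyEq ?_
  filter_upwards [h', (pointCongr (τ : Ω ≃+* Ω) h₁).injective.tendsto_cofinite.eventually h']
  rintro P ⟨x, y, h, rfl, hq, hs, _, hφ⟩ ⟨x', y', h', hP, hq', hs', _, hφ'⟩
  obtain ⟨rfl, rfl⟩ := Point.some.inj hP
  change φ (pointCongr _ h₁ (.some x y h)) = pointCongr _ h₂ (φ (.some x y h))
  rw [hφ', hφ, pointCongr_some, Point.some.injEq]
  exact ⟨by simp [hτ], by simp [hτ]⟩

end RingEquiv

/-! ### Changes of variables -/

section VariableChange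

variable {F Ω : Type*} [Field F] [Field Ω] [Algebra F Ω]

lemma equation_variableChange (W : Affine Ω) (C : VariableChange Ω) {x y : Ω}
    (h : W.Equation x y) : (C • W).toAffine.Equation ((↑C.u⁻¹ : Ω) ^ 2 * (x - C.r))
      ((↑C.u⁻¹ : Ω) ^ 3 * (y - C.s * (x - C.r) - C.t)) := by
  rw [equation_iff'] at h ⊢
  simp only [variableChange_a₁, variableChange_a₂, variableChange_a₃, variableChange_a₄,
    variableChange_a₆]
  linear_combination (↑C.u⁻¹ : Ω) ^ 6 * h

variable [DecidableEq Ω]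

/-- The map on points given by an admissible change of variables. -/
def variableChangeFun (W : Affine Ω) [W.IsElliptic] (C : VariableChange Ω) :
    W.Point → (C • W).toAffine.Point
  | .zero => .zero
  | .some _ _ h => Point.mk (equation_variableChange W C h.1)

lemma variableChangeFun_generic (W : Affine Ω) [W.IsElliptic] (C : VariableChange Ω) (P : W.Point) :
    ∀ᶠ Q in cofinite, variableChangeFun W C (P + Q)
      = variableChangeFun W C P + variableChangeFun W C Q := by
  rcases P with _ | ⟨x₁, y₁, h₁⟩
  · refine Eventually.of_forall fun Q ↦ ?_
    change variableChangeFun W C (0 + Q) = 0 + _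
    rw [zero_add, zero_add]
  filter_upwards [eventually_xCoord_notMem {x₁} (Set.finite_singleton x₁)]
  rintro Q ⟨x₂, y₂, h₂, rfl, hx⟩
  have hx' : x₁ ≠ x₂ := fun h ↦ hx h.symm
  have hd : x₁ - x₂ ≠ 0 := sub_ne_zero.mpr hx'
  have hu : (↑C.u⁻¹ : Ω) ≠ 0 := C.u⁻¹.ne_zero
  have hX : (↑C.u⁻¹ : Ω) ^ 2 * (x₁ - C.r) ≠ (↑C.u⁻¹ : Ω) ^ 2 * (x₂ - C.r) := by
    intro h
    have := mul_left_cancel₀ (pow_ne_zero 2 hu) h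
    exact hx' (by linear_combination this)
  have hS : (C • W).toAffine.slope ((↑C.u⁻¹ : Ω) ^ 2 * (x₁ - C.r)) ((↑C.u⁻¹ : Ω) ^ 2 * (x₂ - C.r))
      ((↑C.u⁻¹ : Ω) ^ 3 * (y₁ - C.s * (x₁ - C.r) - C.t))
      ((↑C.u⁻¹ : Ω) ^ 3 * (y₂ - C.s * (x₂ - C.r) - C.t))
      = (↑C.u⁻¹ : Ω) * (W.slope x₁ x₂ y₁ y₂ - C.s) := by
    rw [slope_of_X_ne hX, slope_of_X_ne hx', div_eq_iff (sub_ne_zero.mpr hX)]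
    field_simp
    ring
  rw [Point.add_of_X_ne hx']
  simp only [variableChangeFun, Point.mk]
  rw [Point.add_of_X_ne hX, Point.some.injEq, hS]
  constructor
  · simp only [addX, variableChange_a₁, variableChange_a₂]
    ring
  · simp only [addY, negAddY, negY, addX, variableChange_a₁, variableChange_a₂, variableChange_a₃]
    ring

variable [IsAlgClosed Ω]

/-- An admissible change of variables with coefficients in `F` is an isomorphism over `F`: it and
its inverse are isogenies over `F`. -/
lemma exists_addEquiv_of_variableChange (W W' : Affine Ω) [W.IsElliptic] (C : VariableChange F)
    (hC : C.map (algebraMap F Ω) • W = W') :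
    ∃ ι : W.Point ≃+ W'.Point, IsIsogenyOver F (ι : W.Point →+ W'.Point) ∧
      IsIsogenyOver F (ι.symm : W'.Point →+ W.Point) ∧
      ∀ x y (h : W.Nonsingular x y), ∃ h',
        ι (.some x y h) = .some (algebraMap F Ω ↑C.u⁻¹ ^ 2 * (x - algebraMap F Ω C.r))
        (algebraMap F Ω ↑C.u⁻¹ ^ 3 * (y - algebraMap F Ω C.s * (x - algebraMap F Ω C.r)
          - algebraMap F Ω C.t)) h' := by
  subst hC
  set D := C.map (algebraMap F Ω) with hD
  have hu : (↑D.u⁻¹ : Ω) * (↑D.u : Ω) = 1 := D.u.inv_mul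
  have hu0 : (↑D.u⁻¹ : Ω) ≠ 0 := D.u⁻¹.ne_zero
  have hinj : Function.Injective (variableChangeFun W D) := by
    rintro (_ | ⟨x₁, y₁, h₁⟩) (_ | ⟨x₂, y₂, h₂⟩) h
    · rfl
    · exact (Point.some_ne_zero _ h.symm).elim
    · exact (Point.some_ne_zero _ h).elim
    · obtain ⟨hx, hy⟩ := Point.some.inj h
      have hx' := mul_left_cancel₀ (pow_ne_zero 2 hu0) hx
      have hy' := mul_left_cancel₀ (pow_ne_zero 3 hu0) hy
      have hx'' : x₁ = x₂ := by linear_combination hx'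
      subst hx''
      have hy'' : y₁ = y₂ := by linear_combination hy'
      subst hy''
      rfl
  have hform : ∀ X Y (hXY : (D • W).toAffine.Nonsingular X Y), ∃ h : W.Nonsingular
      ((D.u : Ω) ^ 2 * X + D.r) ((D.u : Ω) ^ 3 * Y + D.s * (D.u : Ω) ^ 2 * X + D.t),
      variableChangeFun W D (.some _ _ h) = .some X Y hXY := by
    intro X Y hXY
    have hE : W.Equation ((D.u : Ω) ^ 2 * X + D.r)
        ((D.u : Ω) ^ 3 * Y + D.s * (D.u : Ω) ^ 2 * X + D.t) := by
      have := hXY.1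
      rw [equation_iff'] at this ⊢
      simp only [variableChange_a₁, variableChange_a₂, variableChange_a₃, variableChange_a₄,
        variableChange_a₆, Units.val_inv_eq_inv_val] at this
      have hu1 : (D.u : Ω) ≠ 0 := D.u.ne_zero
      field_simp at this
      linear_combination this
    refine ⟨equation_iff_nonsingular.mp hE, ?_⟩
    simp only [variableChangeFun, Point.mk, Point.some.injEq]
    constructor
    · linear_combination (↑D.u⁻¹ * ↑D.u + 1) * X * hu
    · linear_combination ((↑D.u⁻¹ * ↑D.u) ^ 2 + ↑D.u⁻¹ * ↑D.u + 1) * Y * hu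
  have hsurj : Function.Surjective (variableChangeFun W D) := by
    rintro (_ | ⟨X, Y, hXY⟩)
    · exact ⟨.zero, rfl⟩
    · obtain ⟨h, h'⟩ := hform X Y hXY
      exact ⟨_, h'⟩
  let ι : W.Point ≃+ (D • W).toAffine.Point := AddEquiv.ofBijective
    (addMonoidHomOfGeneric _ (variableChangeFun_generic W D)) ⟨hinj, hsurj⟩
  have hι : ∀ P, ι P = variableChangeFun W D P := fun P ↦ rfl
  have c₁ : algebraMap F Ω ↑C.u⁻¹ = (↑D.u⁻¹ : Ω) := by simp [hD, VariableChange.map]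
  have c₀ : algebraMap F Ω ↑C.u = (↑D.u : Ω) := by simp [hD, VariableChange.map]
  have c₂ : algebraMap F Ω C.r = D.r := rfl
  have c₃ : algebraMap F Ω C.s = D.s := rfl
  have c₄ : algebraMap F Ω C.t = D.t := rfl
  have X₁ : IsRatFun F (Point.xCoord (W := W)) := .xCoord
  have Y₁ : IsRatFun F (Point.yCoord (W := W)) := .yCoord
  have X₂ : IsRatFun F (Point.xCoord (W := (D • W).toAffine)) := .xCoord
  have Y₂ : IsRatFun F (Point.yCoord (W := (D • W).toAffine)) := .yCoord
  refine ⟨ι, isIsogenyOver_iff.mpr ⟨?_, ?_, ?_⟩, isIsogenyOver_iff.mpr ⟨?_, ?_, ?_⟩, ?_⟩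
  · refine ((IsRatFun.const ((↑C.u⁻¹ : F) ^ 2)).mul (X₁.sub (.const C.r))).congr ?_
    filter_upwards [eventually_eq_some]
    rintro P ⟨x, y, h, rfl⟩
    simp only [map_pow, c₁, c₂]
    rfl
  · refine ((IsRatFun.const ((↑C.u⁻¹ : F) ^ 3)).mul ((Y₁.sub ((IsRatFun.const C.s).mul
      (X₁.sub (.const C.r)))).sub (.const C.t))).congr ?_
    filter_upwards [eventually_eq_some]
    rintro P ⟨x, y, h, rfl⟩
    simp only [map_pow, c₁, c₂, c₃, c₄]
    rfl
  · filter_upwards [eventually_eq_some]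
    rintro P ⟨x, y, h, rfl⟩
    exact Point.some_ne_zero _
  · refine (((IsRatFun.const ((↑C.u : F) ^ 2)).mul X₂).add (.const C.r)).congr ?_
    filter_upwards [eventually_eq_some]
    rintro P ⟨x, y, h, rfl⟩
    obtain ⟨h₁, h₂⟩ := hform x y h
    simp only [← h₂, ← hι, AddMonoidHom.coe_coe, AddEquiv.symm_apply_apply]
    simp [hι, h₂, c₀, c₂]
  · refine ((((IsRatFun.const ((↑C.u : F) ^ 3)).mul Y₂).add
      ((IsRatFun.const (C.s * (↑C.u : F) ^ 2)).mul X₂)).add (.const C.t)).congr ?_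
    filter_upwards [eventually_eq_some]
    rintro P ⟨x, y, h, rfl⟩
    obtain ⟨h₁, h₂⟩ := hform x y h
    simp only [← h₂, ← hι, AddMonoidHom.coe_coe, AddEquiv.symm_apply_apply]
    simp [hι, h₂, c₀, c₃, c₄]
  · filter_upwards [eventually_eq_some]
    rintro P ⟨x, y, h, rfl⟩
    simp
  · intro x y h
    rw [c₁, c₂, c₃, c₄]
    exact ⟨equation_iff_nonsingular.mp (equation_variableChange W D h.1), rfl⟩

end VariableChange

/-! ### The quotient of `y² = x³ + a x² + b x` by `(0, 0)` on points -/

/-- The curve `y² = x³ + a x² + b x`, on which `(0, 0)` is a point of order two. -/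
def twoCurve {R : Type*} [CommRing R] (a b : R) : WeierstrassCurve R := ⟨0, a, 0, b, 0⟩

lemma map_twoCurve {R S : Type*} [CommRing R] [CommRing S] (f : R →+* S) (a b : R) :
    (twoCurve a b).map f = twoCurve (f a) (f b) := by
  simp [twoCurve, WeierstrassCurve.map]

lemma Δ_twoCurve {R : Type*} [CommRing R] (a b : R) :
    (twoCurve a b).Δ = 16 * b ^ 2 * (a ^ 2 - 4 * b) := by
  simp only [twoCurve, WeierstrassCurve.Δ, b₂, b₄, b₆, b₈]
  ring

section TwoCurve

variable {Ω : Type*} [Field Ω]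

lemma equation_twoCurve (a b x y : Ω) :
    (twoCurve a b).toAffine.Equation x y ↔ y ^ 2 = x ^ 3 + a * x ^ 2 + b * x := by
  rw [equation_iff]
  simp [twoCurve]

lemma isElliptic_twoCurve_iff (a b : Ω) :
    (twoCurve a b).IsElliptic ↔ (2 : Ω) ≠ 0 ∧ b ≠ 0 ∧ a ^ 2 - 4 * b ≠ 0 := by
  rw [isElliptic_iff, Δ_twoCurve, isUnit_iff_ne_zero, show (16 : Ω) = 2 ^ 4 by norm_num]
  simp [and_assoc]

/-- The collinearity identities behind the additivity of the `2`-isogeny. Here `mᵢ = yᵢ / xᵢ` for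
two points `(xᵢ, yᵢ)` of `y² = x³ + a x² + b x` and for their sum `(x₃, y₃)`, and `L` is the slope
of the line through the images of the two points. -/
lemma twoIsog_identity {a b x₁ x₂ x₃ m₁ m₂ m₃ L : Ω} (hx₁ : x₁ ≠ 0) (hx₂ : x₂ ≠ 0)
    (hd : x₁ - x₂ ≠ 0) (hm : m₁ - m₂ ≠ 0) (hm' : m₁ + m₂ ≠ 0)
    (r₁ : m₁ ^ 2 * x₁ = x₁ ^ 2 + a * x₁ + b) (r₂ : m₂ ^ 2 * x₂ = x₂ ^ 2 + a * x₂ + b)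
    (hx : x₃ = x₁ * x₂ * (m₁ - m₂) ^ 2 / (x₁ - x₂) ^ 2)
    (hm₃ : m₃ = (x₁ - x₂) / (m₁ - m₂) - (m₁ * x₁ - m₂ * x₂) / (x₁ - x₂))
    (hL : L = (m₁ * (b / x₁ - x₁) - m₂ * (b / x₂ - x₂)) / (m₁ ^ 2 - m₂ ^ 2)) :
    m₃ ^ 2 = L ^ 2 + 2 * a - m₁ ^ 2 - m₂ ^ 2 ∧
      m₃ * (b / x₃ - x₃) = -(L * (m₃ ^ 2 - m₁ ^ 2) + m₁ * (b / x₁ - x₁)) := by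
  have hb' : b = -(m₁ ^ 2 - m₂ ^ 2 - x₁ + x₂) * x₁ * x₂ / (x₁ - x₂) := by
    field_simp
    linear_combination x₂ * r₁ - x₁ * r₂
  have ha : a = m₁ ^ 2 - x₁ + (m₁ ^ 2 - m₂ ^ 2 - x₁ + x₂) * x₂ / (x₁ - x₂) := by
    field_simp
    linear_combination r₂ - r₁
  have hL' : L = m₁ + m₂ - (x₁ - x₂) / (m₁ - m₂) - (m₁ * x₁ - m₂ * x₂) / (x₁ - x₂) := by
    have : m₁ ^ 2 - m₂ ^ 2 ≠ 0 := by
      rw [sq_sub_sq, mul_comm]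
      exact mul_ne_zero hm hm'
    rw [hL, hb']
    field_simp
    ring
  constructor
  · rw [hL', hm₃, ha]
    field_simp
    ring
  · rw [hL', hm₃, hx, hb']
    field_simp
    ring

lemma equation_dual {a b x y : Ω} (hx : x ≠ 0) (h : (twoCurve a b).toAffine.Equation x y) :
    (twoCurve (-2 * a) (a ^ 2 - 4 * b)).toAffine.Equation (y ^ 2 / x ^ 2)
      (y * (b - x ^ 2) / x ^ 2) := by
  rw [equation_twoCurve] at h ⊢
  have hb : b = (y ^ 2 - x ^ 3 - a * x ^ 2) / x := by
    field_simp
    linear_combination -h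
  rw [hb]
  field_simp
  ring

variable (a b : Ω) [hell : (twoCurve a b).IsElliptic]

instance isElliptic_dual : (twoCurve (-2 * a) (a ^ 2 - 4 * b)).IsElliptic := by
  obtain ⟨h2, hb, hd⟩ := (isElliptic_twoCurve_iff a b).mp hell
  refine (isElliptic_twoCurve_iff _ _).mpr ⟨h2, hd, ?_⟩
  rw [show (-2 * a) ^ 2 - 4 * (a ^ 2 - 4 * b) = 2 ^ 4 * b by ring]
  exact mul_ne_zero (pow_ne_zero 4 h2) hb

/-- The point `(0, 0)`. -/
def twoPoint : (twoCurve a b).toAffine.Point :=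
  Point.mk (x := 0) (y := 0) ((equation_twoCurve a b 0 0).mpr (by simp))

lemma twoPoint_ne_zero : twoPoint a b ≠ 0 := Point.some_ne_zero _

open scoped Classical in
/-- The quotient map of `y² = x³ + a x² + b x` by `(0, 0)`, on points. -/
noncomputable def twoIsogFun : (twoCurve a b).toAffine.Point →
    (twoCurve (-2 * a) (a ^ 2 - 4 * b)).toAffine.Point
  | .zero => 0
  | .some x _ h => if hx : x = 0 then 0 else Point.mk (equation_dual hx h.1)

variable {a b} in
lemma twoIsogFun_some {x y : Ω} (h : (twoCurve a b).toAffine.Nonsingular x y) (hx : x ≠ 0) :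
    twoIsogFun a b (.some x y h) = Point.mk (equation_dual hx h.1) := by
  simp [twoIsogFun, hx]

lemma twoIsogFun_twoPoint : twoIsogFun a b (twoPoint a b) = 0 := by
  simp [twoIsogFun, twoPoint, Point.mk]

variable [DecidableEq Ω]

variable {a b} in
lemma twoPoint_add_some {x y : Ω} (h : (twoCurve a b).toAffine.Nonsingular x y) (hx : x ≠ 0) :
    ∃ h', twoPoint a b + .some x y h = .some (b / x) (-(b * y / x ^ 2)) h' := by
  have hE := (equation_twoCurve a b x y).mp h.1
  have hadd : twoPoint a b + .some x y h = _ := Point.add_of_X_ne (Ne.symm hx)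
  have hs : (twoCurve a b).toAffine.slope 0 x 0 y = y / x := by
    rw [slope_of_X_ne (Ne.symm hx)]
    field_simp
    ring
  have hX : (twoCurve a b).toAffine.addX 0 x (y / x) = b / x := by
    simp only [addX, twoCurve]
    field_simp
    linear_combination hE
  have hY : (twoCurve a b).toAffine.addY 0 x 0 (y / x) = -(b * y / x ^ 2) := by
    simp only [addY, negAddY, negY, hX]
    simp only [twoCurve]
    field_simp
    ring
  rw [hadd]
  have key : ∀ X Y hXY, X = b / x → Y = -(b * y / x ^ 2) →
      ∃ h', (Point.some X Y hXY : (twoCurve a b).toAffine.Point)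
        = .some (b / x) (-(b * y / x ^ 2)) h' := by
    rintro X Y hXY rfl rfl
    exact ⟨hXY, rfl⟩
  exact key _ _ _ (by rw [hs, hX]) (by rw [hs, hY])

lemma twoIsogFun_generic (P : (twoCurve a b).toAffine.Point) :
    ∀ᶠ Q in cofinite, twoIsogFun a b (P + Q) = twoIsogFun a b P + twoIsogFun a b Q := by
  obtain ⟨h2, hb, hd⟩ := (isElliptic_twoCurve_iff a b).mp hell
  rcases P with _ | ⟨x₁, y₁, h₁⟩
  · refine Eventually.of_forall fun Q ↦ ?_
    change twoIsogFun a b (0 + Q) = 0 + _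
    rw [zero_add, zero_add]
  have e₁ := (equation_twoCurve a b x₁ y₁).mp h₁.1
  by_cases hx₁ : x₁ = 0
  · subst hx₁
    have hy₁ : y₁ = 0 := by simpa using e₁
    subst hy₁
    filter_upwards [eventually_xCoord_notMem {0} (Set.finite_singleton 0)]
    rintro Q ⟨x, y, h, rfl, hx : x ≠ 0⟩
    have e := (equation_twoCurve a b x y).mp h.1
    obtain ⟨h', hadd⟩ := twoPoint_add_some h hx
    change twoIsogFun a b (twoPoint a b + _) = twoIsogFun a b (twoPoint a b) + _
    rw [twoIsogFun_twoPoint, zero_add, hadd, twoIsogFun_some _ (div_ne_zero hb hx),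
      twoIsogFun_some _ hx]
    simp only [Point.mk, Point.some.injEq]
    constructor
    · field_simp
    · field_simp
      ring
  · -- the abscissae `x₂` for which both images have the same abscissa
    let f : Polynomial Ω := Polynomial.X ^ 2 + Polynomial.C (a - y₁ ^ 2 / x₁ ^ 2) * Polynomial.X
      + Polynomial.C b
    have hf : f ≠ 0 := by
      apply Polynomial.ne_zero_of_degree_gt (n := 1)
      have : f.degree = 2 := by
        simp only [f]
        compute_degree!
      rw [this]
      decide
    have htr : Tendsto (Point.some x₁ y₁ h₁ + ·) cofinite cofinite :=
      (add_right_injective _).tendsto_cofinite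
    filter_upwards [eventually_xCoord_notMem {0, x₁} (Set.toFinite _), eventually_eval_ne_zero hf,
      htr.eventually (eventually_xCoord_notMem {0} (Set.finite_singleton 0))]
    rintro Q ⟨x₂, y₂, h₂, rfl, hx⟩ ⟨x₂', y₂', h₂', hQ, hf₂⟩ ⟨x₃, y₃, h₃, hQ₃, hx₃ : x₃ ≠ 0⟩
    obtain ⟨rfl, rfl⟩ := Point.some.inj hQ
    have e₂ := (equation_twoCurve a b x₂ y₂).mp h₂.1
    obtain ⟨hx₂, hx₁₂⟩ : x₂ ≠ 0 ∧ x₂ ≠ x₁ := by simpa using hx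
    have hd₁₂ : x₁ - x₂ ≠ 0 := sub_ne_zero.mpr hx₁₂.symm
    obtain ⟨m₁, rfl⟩ : ∃ m, y₁ = m * x₁ := ⟨y₁ / x₁, by field_simp⟩
    obtain ⟨m₂, rfl⟩ : ∃ m, y₂ = m * x₂ := ⟨y₂ / x₂, by field_simp⟩
    have r₁ : m₁ ^ 2 * x₁ = x₁ ^ 2 + a * x₁ + b :=
      mul_left_cancel₀ hx₁ (by linear_combination e₁)
    have r₂ : m₂ ^ 2 * x₂ = x₂ ^ 2 + a * x₂ + b :=
      mul_left_cancel₀ hx₂ (by linear_combination e₂)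
    have hmm : m₁ ^ 2 - m₂ ^ 2 ≠ 0 := by
      intro h0
      apply hf₂
      simp only [f, Polynomial.eval_add, Polynomial.eval_mul, Polynomial.eval_pow,
        Polynomial.eval_X, Polynomial.eval_C]
      field_simp
      linear_combination -r₂ - x₂ * h0
    have hm : m₁ - m₂ ≠ 0 := fun h ↦ hmm (by linear_combination (m₁ + m₂) * h)
    have hs : (twoCurve a b).toAffine.slope x₁ x₂ (m₁ * x₁) (m₂ * x₂)
        = (m₁ * x₁ - m₂ * x₂) / (x₁ - x₂) := slope_of_X_ne hx₁₂.symm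
    have ha : a = m₁ ^ 2 - x₁ - b / x₁ := by
      field_simp
      linear_combination -r₁
    have hb' : b = (m₁ ^ 2 - m₂ ^ 2 - x₁ + x₂) * x₁ * x₂ / (x₂ - x₁) := by
      have : x₂ - x₁ ≠ 0 := sub_ne_zero.mpr hx₁₂
      field_simp
      linear_combination x₁ * r₂ - x₂ * r₁
    rw [Point.add_of_X_ne hx₁₂.symm] at hQ₃ ⊢
    obtain ⟨hX₃, hY₃⟩ := Point.some.inj hQ₃
    rw [hs] at hX₃ hY₃
    have hX₃' : x₃ = x₁ * x₂ * (m₁ - m₂) ^ 2 / (x₁ - x₂) ^ 2 := by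
      rw [← hX₃]
      simp only [addX, twoCurve]
      have : x₂ - x₁ ≠ 0 := sub_ne_zero.mpr hx₁₂
      rw [ha, hb']
      field_simp
      ring
    have hY₃' : y₃ = -(x₃ * ((m₁ * x₁ - m₂ * x₂) / (x₁ - x₂) - (x₁ - x₂) / (m₁ - m₂))) := by
      rw [← hY₃]
      simp only [addY, negAddY, negY, hX₃]
      simp only [twoCurve]
      rw [hX₃']
      field_simp
      ring
    have hXne : (m₁ * x₁) ^ 2 / x₁ ^ 2 ≠ (m₂ * x₂) ^ 2 / x₂ ^ 2 := by
      intro h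
      field_simp at h
      exact hmm (by linear_combination h)
    have h₃' : ∀ h, twoIsogFun a b (.some ((twoCurve a b).toAffine.addX x₁ x₂
        ((twoCurve a b).toAffine.slope x₁ x₂ (m₁ * x₁) (m₂ * x₂)))
        ((twoCurve a b).toAffine.addY x₁ x₂ (m₁ * x₁)
        ((twoCurve a b).toAffine.slope x₁ x₂ (m₁ * x₁) (m₂ * x₂))) h)
        = Point.mk (equation_dual hx₃ h₃.1) := by
      intro h
      rw [← twoIsogFun_some h₃ hx₃]
      congr 1
    rw [h₃', twoIsogFun_some h₁ hx₁, twoIsogFun_some h₂ hx₂]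
    simp only [Point.mk]
    rw [Point.add_of_X_ne hXne, Point.some.injEq, slope_of_X_ne hXne]
    have hS : (m₁ * x₁ * (b - x₁ ^ 2) / x₁ ^ 2 - m₂ * x₂ * (b - x₂ ^ 2) / x₂ ^ 2) /
        ((m₁ * x₁) ^ 2 / x₁ ^ 2 - (m₂ * x₂) ^ 2 / x₂ ^ 2)
        = (m₁ * (b / x₁ - x₁) - m₂ * (b / x₂ - x₂)) / (m₁ ^ 2 - m₂ ^ 2) := by
      congr 1 <;> field_simp
    rw [hS]
    obtain ⟨i₁, i₂⟩ := twoIsog_identity hx₁ hx₂ hd₁₂ hm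
      (fun h ↦ hmm (by linear_combination (m₁ - m₂) * h)) r₁ r₂ hX₃' rfl rfl
    set m₃ := (x₁ - x₂) / (m₁ - m₂) - (m₁ * x₁ - m₂ * x₂) / (x₁ - x₂) with hm₃
    set L := (m₁ * (b / x₁ - x₁) - m₂ * (b / x₂ - x₂)) / (m₁ ^ 2 - m₂ ^ 2)
    have hy₃ : y₃ = m₃ * x₃ := by rw [hY₃', hm₃]; ring
    have q : ∀ m x : Ω, x ≠ 0 → (m * x) ^ 2 / x ^ 2 = m ^ 2 := fun m x hx ↦ by field_simp
    have q' : ∀ m x : Ω, x ≠ 0 → m * x * (b - x ^ 2) / x ^ 2 = m * (b / x - x) :=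
      fun m x hx ↦ by field_simp
    have hX : (twoCurve (-2 * a) (a ^ 2 - 4 * b)).toAffine.addX (m₁ ^ 2) (m₂ ^ 2) L = m₃ ^ 2 := by
      rw [i₁]
      simp only [addX, twoCurve]
      ring
    rw [hy₃, q _ _ hx₁, q _ _ hx₂, q _ _ hx₃, q' _ _ hx₁, q' _ _ hx₃, hX]
    refine ⟨rfl, ?_⟩
    simp only [addY, negAddY, negY, hX]
    simp only [twoCurve]
    linear_combination i₂

end TwoCurve

/-! ### The `2`-isogeny with kernel generated by `(0, 0)`, and descent along it -/

section TwoIsogeny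

variable {Ω : Type*} [Field Ω]

lemma exists_quadratic_root [IsAlgClosed Ω] (c d : Ω) : ∃ x : Ω, x ^ 2 + c * x + d = 0 := by
  let f : Polynomial Ω := Polynomial.X ^ 2 + Polynomial.C c * Polynomial.X + Polynomial.C d
  have hf : f.degree = 2 := by
    simp only [f]
    compute_degree!
  obtain ⟨x, hx⟩ := IsAlgClosed.exists_root f (by rw [hf]; decide)
  exact ⟨x, by simpa [f] using hx⟩

variable (a b : Ω)

lemma eventually_twoCurve_ne : ∀ᶠ P : (twoCurve a b).toAffine.Point in cofinite, ∃ x y,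
    ∃ h : (twoCurve a b).toAffine.Nonsingular x y, P = .some x y h ∧ x ≠ 0 ∧ y ≠ 0 ∧
      b - x ^ 2 ≠ 0 := by
  let f : Polynomial Ω := Polynomial.C b - Polynomial.X ^ 2
  let g : Polynomial Ω := Polynomial.X ^ 2 + Polynomial.C a * Polynomial.X + Polynomial.C b
  have hf : f ≠ 0 := by
    apply Polynomial.ne_zero_of_degree_gt (n := 1)
    have : f.degree = 2 := by
      simp only [f]
      compute_degree!
    rw [this]
    decide
  have hg : g ≠ 0 := by
    apply Polynomial.ne_zero_of_degree_gt (n := 1)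
    have : g.degree = 2 := by
      simp only [g]
      compute_degree!
    rw [this]
    decide
  filter_upwards [eventually_eval_ne_zero (mul_ne_zero (mul_ne_zero hf hg) Polynomial.X_ne_zero)]
  rintro P ⟨x, y, h, rfl, h0⟩
  simp only [f, g, Polynomial.eval_mul, Polynomial.eval_sub, Polynomial.eval_add,
    Polynomial.eval_C, Polynomial.eval_X, Polynomial.eval_pow, mul_ne_zero_iff] at h0
  refine ⟨x, y, h, rfl, h0.2, ?_, h0.1.1⟩
  rintro rfl
  refine mul_ne_zero h0.2 h0.1.2 ?_
  linear_combination -(equation_twoCurve a b x 0).mp h.1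

/-- Over the function field of the quotient curve, with coordinates `(X, Y)`, every polynomial in
`x` and `y` becomes linear in `x` after multiplication by a power of `X² - 2 a X + a² - 4 b`: the
quotient map has degree two. -/
lemma exists_linear_form {F : Type*} [Field F] [Algebra F Ω] (a₀ b₀ : F)
    (ha : algebraMap F Ω a₀ = a) (hb : algebraMap F Ω b₀ = b) (q : MvPolynomial (Fin 2) F) :
    ∃ (d : ℕ) (A B : MvPolynomial (Fin 2) F), ∀ x y X Y : Ω, x ^ 2 + (a - X) * x + b = 0 →
      y * (4 * b - (X - a) ^ 2) = Y * ((X - a) * x - 2 * b) →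
      (4 * b - (X - a) ^ 2) ^ d * MvPolynomial.aeval ![x, y] q
        = MvPolynomial.aeval ![X, Y] A + MvPolynomial.aeval ![X, Y] B * x := by
  let D : MvPolynomial (Fin 2) F :=
    4 * MvPolynomial.C b₀ - (MvPolynomial.X 0 - MvPolynomial.C a₀) ^ 2
  let S : MvPolynomial (Fin 2) F := MvPolynomial.X 0 - MvPolynomial.C a₀
  let T : MvPolynomial (Fin 2) F := MvPolynomial.X 1
  have hD : ∀ X Y : Ω, MvPolynomial.aeval ![X, Y] D = 4 * b - (X - a) ^ 2 := by
    intro X Y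
    simp [D, ha, hb]
  have hS : ∀ X Y : Ω, MvPolynomial.aeval ![X, Y] S = X - a := by
    intro X Y
    simp [S, ha]
  have hT : ∀ X Y : Ω, MvPolynomial.aeval ![X, Y] T = Y := by
    intro X Y
    simp [T]
  induction q using MvPolynomial.induction_on with
  | C c => exact ⟨0, MvPolynomial.C c, 0, fun x y X Y _ _ ↦ by simp⟩
  | add p q hp hq =>
    obtain ⟨d, A, B, h⟩ := hp
    obtain ⟨d', A', B', h'⟩ := hq
    refine ⟨d + d', D ^ d' * A + D ^ d * A', D ^ d' * B + D ^ d * B', fun x y X Y hx hy ↦ ?_⟩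
    have e := h x y X Y hx hy
    have e' := h' x y X Y hx hy
    simp only [map_add, map_mul, map_pow, hD]
    linear_combination (4 * b - (X - a) ^ 2) ^ d' * e + (4 * b - (X - a) ^ 2) ^ d * e'
  | mul_X p i hp =>
    obtain ⟨d, A, B, h⟩ := hp
    fin_cases i
    · refine ⟨d, -MvPolynomial.C b₀ * B, A + S * B, fun x y X Y hx hy ↦ ?_⟩
      have e := h x y X Y hx hy
      simp only [map_add, map_mul, map_neg, hS, MvPolynomial.aeval_C, hb, MvPolynomial.aeval_X,
        Fin.zero_eta, Matrix.cons_val_zero]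
      linear_combination x * e + MvPolynomial.aeval ![X, Y] B * hx
    · refine ⟨d + 1, -(2 * MvPolynomial.C b₀ * T * A) - MvPolynomial.C b₀ * S * T * B,
        T * S * A + (S ^ 2 - 2 * MvPolynomial.C b₀) * T * B, fun x y X Y hx hy ↦ ?_⟩
      have e := h x y X Y hx hy
      simp only [map_add, map_sub, map_mul, map_neg, map_pow, map_ofNat, hS, hT,
        MvPolynomial.aeval_C, hb, MvPolynomial.aeval_X, Fin.mk_one, Matrix.cons_val_one,
        Matrix.cons_val_fin_one]
      linear_combination (4 * b - (X - a) ^ 2) * y * e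
        + (MvPolynomial.aeval ![X, Y] A + MvPolynomial.aeval ![X, Y] B * x) * hy
        + MvPolynomial.aeval ![X, Y] B * Y * (X - a) * hx

variable [DecidableEq Ω] [IsAlgClosed Ω] [hell : (twoCurve a b).IsElliptic]

/-- The `2`-isogeny from `y² = x³ + a x² + b x` to `y² = x³ - 2 a x² + (a² - 4 b) x` with kernel
generated by `(0, 0)`. -/
noncomputable def twoIsog : (twoCurve a b).toAffine.Point →+
    (twoCurve (-2 * a) (a ^ 2 - 4 * b)).toAffine.Point :=
  addMonoidHomOfGeneric (twoIsogFun a b) (twoIsogFun_generic a b)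

variable {a b} in
lemma twoIsog_some {x y : Ω} (h : (twoCurve a b).toAffine.Nonsingular x y) (hx : x ≠ 0) :
    twoIsog a b (.some x y h) = Point.mk (equation_dual hx h.1) :=
  twoIsogFun_some h hx

lemma twoIsog_twoPoint : twoIsog a b (twoPoint a b) = 0 := twoIsogFun_twoPoint a b

lemma twoIsog_eq_zero_iff (P : (twoCurve a b).toAffine.Point) :
    twoIsog a b P = 0 ↔ P = 0 ∨ P = twoPoint a b := by
  constructor
  · rcases P with _ | ⟨x, y, h⟩
    · exact fun _ ↦ Or.inl rfl
    · intro h0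
      right
      have hx : x = 0 := by
        by_contra hx
        rw [twoIsog_some h hx] at h0
        exact Point.some_ne_zero _ h0
      subst hx
      have hy : y = 0 := by simpa using (equation_twoCurve a b 0 y).mp h.1
      subst hy
      rfl
  · rintro (rfl | rfl)
    · exact map_zero _
    · exact twoIsog_twoPoint a b

lemma twoIsog_surjective : Function.Surjective (twoIsog a b) := by
  obtain ⟨h2, hb, hd⟩ := (isElliptic_twoCurve_iff a b).mp hell
  have key : ∀ X Y (h : (twoCurve (-2 * a) (a ^ 2 - 4 * b)).toAffine.Nonsingular X Y) (x y : Ω),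
      x ≠ 0 → y ^ 2 = x ^ 3 + a * x ^ 2 + b * x → X * x ^ 2 = y ^ 2 →
      Y * x ^ 2 = y * (b - x ^ 2) → ∃ P, twoIsog a b P = .some X Y h := by
    intro X Y h x y hx hE hX hY
    refine ⟨Point.mk ((equation_twoCurve a b x y).mpr hE), ?_⟩
    rw [Point.mk, twoIsog_some _ hx, Point.mk, Point.some.injEq]
    constructor
    · rw [← hX]
      field_simp
    · rw [← hY]
      field_simp
  rintro (_ | ⟨X, Y, h⟩)
  · exact ⟨0, rfl⟩
  have hE := (equation_twoCurve _ _ X Y).mp h.1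
  obtain ⟨x, hx⟩ := exists_quadratic_root (a - X) b
  have hx0 : x ≠ 0 := by
    rintro rfl
    exact hb (by simpa using hx)
  by_cases hbx : b - x ^ 2 = 0
  · obtain ⟨y, hy⟩ := exists_quadratic_root 0 (-(X * x ^ 2))
    have hbx' : b = x ^ 2 := sub_eq_zero.mp hbx
    have hY : Y = 0 := by
      have hX : X = a + 2 * x := mul_left_cancel₀ hx0 (by linear_combination -hx + hbx)
      rw [hX, hbx'] at hE
      exact pow_eq_zero_iff two_ne_zero |>.mp (by linear_combination hE)
    refine key X Y h x y hx0 (by linear_combination hy - x * hx) (by linear_combination -hy) ?_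
    rw [hY, hbx]
    ring
  · have hX : X = (x ^ 2 + a * x + b) / x := by
      field_simp
      linear_combination -hx
    have hY2 : Y ^ 2 = X * ((b - x ^ 2) / x) ^ 2 := by
      rw [hE, hX]
      field_simp
      ring
    refine key X Y h x (Y * x ^ 2 / (b - x ^ 2)) hx0 ?_ ?_ (by field_simp)
    · rw [div_pow, mul_pow, hY2, hX]
      field_simp
    · rw [div_pow, mul_pow, hY2]
      field_simp

lemma isIsogenyOver_twoIsog {F : Type*} [Field F] [Algebra F Ω] (b₀ : F)
    (hb : algebraMap F Ω b₀ = b) : IsIsogenyOver F (twoIsog a b) := by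
  have X₁ : IsRatFun F (Point.xCoord (W := (twoCurve a b).toAffine)) := .xCoord
  have Y₁ : IsRatFun F (Point.yCoord (W := (twoCurve a b).toAffine)) := .yCoord
  have hx0 : ∀ᶠ P : (twoCurve a b).toAffine.Point in cofinite, P.xCoord ^ 2 ≠ 0 := by
    filter_upwards [eventually_twoCurve_ne a b]
    rintro P ⟨x, y, h, rfl, hx, -, -⟩
    simpa using hx
  refine isIsogenyOver_iff.mpr ⟨?_, ?_, ?_⟩
  · refine ((Y₁.pow 2).div (X₁.pow 2) hx0).congr ?_
    filter_upwards [eventually_twoCurve_ne a b]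
    rintro P ⟨x, y, h, rfl, hx, -, -⟩
    rw [twoIsog_some h hx]
    rfl
  · refine ((Y₁.mul ((IsRatFun.const b₀).sub (X₁.pow 2))).div (X₁.pow 2) hx0).congr ?_
    filter_upwards [eventually_twoCurve_ne a b]
    rintro P ⟨x, y, h, rfl, hx, -, -⟩
    rw [twoIsog_some h hx, hb]
    rfl
  · filter_upwards [eventually_twoCurve_ne a b]
    rintro P ⟨x, y, h, rfl, hx, -, -⟩
    rw [twoIsog_some h hx]
    exact Point.some_ne_zero _

/-- A function on the quotient curve is rational over `F` if its pullback is: it is obtained from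
the pullback by averaging over the translation by `(0, 0)`. -/
lemma isRatFun_of_comp_twoIsog {F : Type*} [Field F] [Algebra F Ω] (a₀ b₀ : F)
    (ha : algebraMap F Ω a₀ = a) (hb : algebraMap F Ω b₀ = b)
    {g : (twoCurve (-2 * a) (a ^ 2 - 4 * b)).toAffine.Point → Ω}
    (hg : IsRatFun F fun P ↦ g (twoIsog a b P)) : IsRatFun F g := by
  obtain ⟨h2, hb0, hd⟩ := (isElliptic_twoCurve_iff a b).mp hell
  obtain ⟨p, q, hpq⟩ := hg
  obtain ⟨m, A, B, hAB⟩ := exists_linear_form a b a₀ b₀ ha hb p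
  obtain ⟨n, A', B', hAB'⟩ := exists_linear_form a b a₀ b₀ ha hb q
  let D : MvPolynomial (Fin 2) F :=
    4 * MvPolynomial.C b₀ - (MvPolynomial.X 0 - MvPolynomial.C a₀) ^ 2
  let S : MvPolynomial (Fin 2) F := MvPolynomial.X 0 - MvPolynomial.C a₀
  -- with `p` and `q` linear in `x`, this is the mean of `p / q` at `x` and its conjugate `b / x`,
  -- expressed by the trace `S = x + b / x` and the norm `b`
  refine ⟨D ^ n * (2 * A * A' + 2 * MvPolynomial.C b₀ * B * B' + (B * A' + A * B') * S),
    D ^ m * (2 * (A' ^ 2 + A' * B' * S + MvPolynomial.C b₀ * B' ^ 2)), ?_⟩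
  have hT : Tendsto (twoPoint a b + ·) cofinite cofinite :=
    (add_right_injective _).tendsto_cofinite
  have hall := (eventually_twoCurve_ne a b).and (hpq.and (hT.eventually hpq))
  rw [eventually_cofinite] at hall ⊢
  refine (hall.image (twoIsog a b)).subset fun Q hQ ↦ ?_
  obtain ⟨P, rfl⟩ := twoIsog_surjective a b Q
  refine ⟨P, fun hP ↦ hQ ?_, rfl⟩
  obtain ⟨⟨x, y, h, rfl, hx, hy, hbx⟩, ⟨x₁, y₁, h₁, hP₁, hq₁, hg₁⟩,
    ⟨x₂, y₂, h₂, hP₂, hq₂, hg₂⟩⟩ := hP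
  obtain ⟨rfl, rfl⟩ := Point.some.inj hP₁
  obtain ⟨h', hadd⟩ := twoPoint_add_some h hx
  obtain ⟨rfl, rfl⟩ := Point.some.inj (hP₂.symm.trans hadd)
  change g (twoIsog a b _) = _ at hg₁ hg₂
  rw [map_add, twoIsog_twoPoint, zero_add] at hg₂
  have hE := (equation_twoCurve a b x y).mp h.1
  refine ⟨_, _, _, twoIsog_some h hx, ?_⟩
  rw [hg₁] at hg₂ ⊢
  set X := y ^ 2 / x ^ 2 with hX
  set Y := y * (b - x ^ 2) / x ^ 2 with hY
  have hXa : X - a = x + b / x := by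
    rw [hX, hE]
    field_simp
    ring
  have hDX : 4 * b - (X - a) ^ 2 = -((b - x ^ 2) / x) ^ 2 := by
    rw [hXa]
    field_simp
    ring
  have hDX0 : 4 * b - (X - a) ^ 2 ≠ 0 := by
    rw [hDX]
    exact neg_ne_zero.mpr (pow_ne_zero 2 (div_ne_zero hbx hx))
  have r₁ : x ^ 2 + (a - X) * x + b = 0 := by
    have : a - X = -(x + b / x) := by rw [← hXa]; ring
    rw [this]
    field_simp
    ring
  have r₂ : (b / x) ^ 2 + (a - X) * (b / x) + b = 0 := by
    have : a - X = -(x + b / x) := by rw [← hXa]; ring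
    rw [this]
    field_simp
    ring
  have s₁ : y * (4 * b - (X - a) ^ 2) = Y * ((X - a) * x - 2 * b) := by
    rw [hDX, hXa, hY]
    field_simp
    ring
  have s₂ : -(b * y / x ^ 2) * (4 * b - (X - a) ^ 2) = Y * ((X - a) * (b / x) - 2 * b) := by
    rw [hDX, hXa, hY]
    field_simp
    ring
  have p₁ := hAB _ _ _ _ r₁ s₁
  have p₂ := hAB _ _ _ _ r₂ s₂
  have q₁ := hAB' _ _ _ _ r₁ s₁
  have q₂ := hAB' _ _ _ _ r₂ s₂
  have hD : MvPolynomial.aeval ![X, Y] D = 4 * b - (X - a) ^ 2 := by simp [D, ha, hb]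
  have hS : MvPolynomial.aeval ![X, Y] S = x + b / x := by simp [S, ha, hXa]
  have hxx : x * (b / x) = b := by field_simp
  simp only [map_add, map_mul, map_pow, map_ofNat, hD, hS, MvPolynomial.aeval_C, hb]
  set D₀ := 4 * b - (X - a) ^ 2
  set A₀ := MvPolynomial.aeval ![X, Y] A
  set B₀ := MvPolynomial.aeval ![X, Y] B
  set A₁ := MvPolynomial.aeval ![X, Y] A'
  set B₁ := MvPolynomial.aeval ![X, Y] B'
  set P₁ := MvPolynomial.aeval ![x, y] p
  set Q₁ := MvPolynomial.aeval ![x, y] q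
  set P₂ := MvPolynomial.aeval ![b / x, -(b * y / x ^ 2)] p
  set Q₂ := MvPolynomial.aeval ![b / x, -(b * y / x ^ 2)] q
  have hN : A₁ ^ 2 + A₁ * B₁ * (x + b / x) + b * B₁ ^ 2 = D₀ ^ n * Q₁ * (D₀ ^ n * Q₂) := by
    rw [q₁, q₂]
    linear_combination -B₁ ^ 2 * hxx
  have hM : 2 * A₀ * A₁ + 2 * b * B₀ * B₁ + (B₀ * A₁ + A₀ * B₁) * (x + b / x)
      = D₀ ^ m * P₁ * (D₀ ^ n * Q₂) + D₀ ^ m * P₂ * (D₀ ^ n * Q₁) := by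
    rw [p₁, p₂, q₁, q₂]
    linear_combination -2 * B₀ * B₁ * hxx
  rw [hN, hM]
  have hcross : P₁ * Q₂ = P₂ * Q₁ := by
    field_simp at hg₂
    rw [hg₂, mul_comm]
  have hden : D₀ ^ m * (2 * (D₀ ^ n * Q₁ * (D₀ ^ n * Q₂))) ≠ 0 :=
    mul_ne_zero (pow_ne_zero m hDX0) (mul_ne_zero h2 (mul_ne_zero
      (mul_ne_zero (pow_ne_zero n hDX0) hq₁) (mul_ne_zero (pow_ne_zero n hDX0) hq₂)))
  refine ⟨hden, ?_⟩
  rw [div_eq_div_iff hq₁ hden]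
  linear_combination D₀ ^ n * D₀ ^ m * D₀ ^ n * Q₁ * hcross

/-- An isogeny over `F` that kills `(0, 0)` factors over `F` through the quotient map. -/
lemma exists_factor_twoIsog {F : Type*} [Field F] [Algebra F Ω] (a₀ b₀ : F)
    (ha : algebraMap F Ω a₀ = a) (hb : algebraMap F Ω b₀ = b) {W : Affine Ω}
    {φ : (twoCurve a b).toAffine.Point →+ W.Point} (hφ : IsIsogenyOver F φ)
    (h0 : φ (twoPoint a b) = 0) :
    ∃ χ : (twoCurve (-2 * a) (a ^ 2 - 4 * b)).toAffine.Point →+ W.Point,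
      IsIsogenyOver F χ ∧ χ.comp (twoIsog a b) = φ := by
  have hker : (twoIsog a b).ker ≤ φ.ker := by
    intro P hP
    rcases (twoIsog_eq_zero_iff a b P).mp hP with rfl | rfl
    · exact zero_mem _
    · exact h0
  let χ := (twoIsog a b).liftOfSurjective (twoIsog_surjective a b) ⟨φ, hker⟩
  have hχ : χ.comp (twoIsog a b) = φ :=
    (twoIsog a b).liftOfRightInverse_comp _ _ ⟨φ, hker⟩
  refine ⟨χ, ?_, hχ⟩
  have hχ' : ∀ P, χ (twoIsog a b P) = φ P := DFunLike.congr_fun hχ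
  obtain ⟨hx, hy, hne⟩ := isIsogenyOver_iff.mp hφ
  refine isIsogenyOver_iff.mpr ⟨?_, ?_, ?_⟩
  · exact isRatFun_of_comp_twoIsog a b a₀ b₀ ha hb (by simpa only [hχ'] using hx)
  · exact isRatFun_of_comp_twoIsog a b a₀ b₀ ha hb (by simpa only [hχ'] using hy)
  · rw [eventually_cofinite] at hne ⊢
    refine (hne.image (twoIsog a b)).subset fun Q hQ ↦ ?_
    obtain ⟨P, rfl⟩ := twoIsog_surjective a b Q
    exact ⟨P, by simpa [hχ'] using hQ, rfl⟩

end TwoIsogeny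

/-! ### The quotient by a rational point of order two -/

section Quotient

variable {F Ω : Type*} [Field F] [Field Ω] [Algebra F Ω]

instance isElliptic_baseChange (E : WeierstrassCurve F) [E.IsElliptic] :
    (E.baseChange Ω).IsElliptic :=
  inferInstanceAs (E.map (algebraMap F Ω)).IsElliptic

variable [DecidableEq Ω] [IsAlgClosed Ω]

/-- The dual of the `2`-isogeny is the `2`-isogeny of the quotient curve followed by the change of
variables `(X, Y) ↦ (X / 4, Y / 8)`. -/
lemma exists_dual_twoIsog (a b : Ω) [hell : (twoCurve a b).IsElliptic] (h2F : (2 : F) ≠ 0) :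
    ∃ ρ : (twoCurve (-2 * (-2 * a)) ((-2 * a) ^ 2 - 4 * (a ^ 2 - 4 * b))).toAffine.Point ≃+
        (twoCurve a b).toAffine.Point,
      IsIsogenyOver F
        (ρ : (twoCurve (-2 * (-2 * a)) ((-2 * a) ^ 2 - 4 * (a ^ 2 - 4 * b))).toAffine.Point →+
          (twoCurve a b).toAffine.Point) ∧
      IsIsogenyOver F (ρ.symm : (twoCurve a b).toAffine.Point →+
        (twoCurve (-2 * (-2 * a)) ((-2 * a) ^ 2 - 4 * (a ^ 2 - 4 * b))).toAffine.Point) ∧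
      ∀ P, ρ (twoIsog _ _ (twoIsog a b P)) = (2 : ℕ) • P := by
  obtain ⟨h2, hb, hd⟩ := (isElliptic_twoCurve_iff a b).mp hell
  let C : VariableChange F := ⟨Units.mk0 2 h2F, 0, 0, 0⟩
  have hu : algebraMap F Ω ↑C.u⁻¹ = 2⁻¹ := by simp [C, map_ofNat]
  have hC : C.map (algebraMap F Ω) •
      twoCurve (-2 * (-2 * a)) ((-2 * a) ^ 2 - 4 * (a ^ 2 - 4 * b)) = twoCurve a b := by
    ext
    · simp [variableChange_a₁, VariableChange.map, C, twoCurve]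
    · simp [variableChange_a₂, VariableChange.map, C, twoCurve, map_ofNat]
      field_simp
    · simp [variableChange_a₃, VariableChange.map, C, twoCurve]
    · simp [variableChange_a₄, VariableChange.map, C, twoCurve, map_ofNat]
      field_simp
      ring
    · simp [variableChange_a₆, VariableChange.map, C, twoCurve]
  obtain ⟨ρ, hρ, hρ', hform⟩ := exists_addEquiv_of_variableChange _ _ C hC
  refine ⟨ρ, hρ, hρ', fun P ↦ ?_⟩
  suffices (ρ : (twoCurve (-2 * (-2 * a)) ((-2 * a) ^ 2 - 4 * (a ^ 2 - 4 * b))).toAffine.Point →+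
      (twoCurve a b).toAffine.Point).comp ((twoIsog _ _).comp (twoIsog a b))
      = nsmulAddMonoidHom 2 from DFunLike.congr_fun this P
  refine eq_of_eventuallyEq ?_
  filter_upwards [eventually_twoCurve_ne a b]
  rintro P ⟨x, y, h, rfl, hx, hy, hbx⟩
  have hE := (equation_twoCurve a b x y).mp h.1
  have hX : y ^ 2 / x ^ 2 ≠ 0 := div_ne_zero (pow_ne_zero 2 hy) (pow_ne_zero 2 hx)
  have hyn : y ≠ (twoCurve a b).toAffine.negY x y := by
    simp only [negY, twoCurve]
    intro h
    exact mul_ne_zero h2 hy (by linear_combination h)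
  change ρ (twoIsog _ _ (twoIsog a b (.some x y h))) = (2 : ℕ) • Point.some x y h
  rw [twoIsog_some h hx, Point.mk, twoIsog_some _ hX, Point.mk, two_nsmul,
    Point.add_self_of_Y_ne hyn]
  obtain ⟨h', hf⟩ := hform _ _ (equation_iff_nonsingular.mp
    (equation_dual hX (equation_dual hx h.1)))
  have hr : algebraMap F Ω C.r = 0 := map_zero _
  rw [hf, Point.some.injEq, hu, hr, slope_of_Y_ne rfl hyn]
  have hb' : b = (y ^ 2 - x ^ 3 - a * x ^ 2) / x := by
    field_simp
    linear_combination -hE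
  have hX' : (twoCurve a b).toAffine.addX x x ((3 * x ^ 2 + 2 * (twoCurve a b).a₂ * x
      + (twoCurve a b).a₄ - (twoCurve a b).a₁ * y) / (y - (twoCurve a b).toAffine.negY x y))
      = (b - x ^ 2) ^ 2 / (4 * y ^ 2) := by
    have : y - (-y - 0 * x - 0) = 2 * y := by ring
    simp only [addX, negY, twoCurve, this]
    have h4 : (4 : Ω) = 2 * 2 := by norm_num
    rw [hb', h4]
    field_simp
    ring
  constructor
  · rw [hX']
    rw [sub_zero]
    have h4 : (4 : Ω) = 2 * 2 := by norm_num
    rw [h4]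
    field_simp
  · simp only [addY, negAddY, hX']
    simp only [negY, twoCurve]
    have h4 : (4 : Ω) = 2 * 2 := by norm_num
    have : y - (-y - 0 * x - 0) = 2 * y := by ring
    rw [this, hb', h4]
    field_simp
    ring

/-- An elliptic curve with a rational point `T` of order two is isomorphic to some
`y² = x³ + a x² + b x`, with `T` going to `(0, 0)`. -/
lemma exists_addEquiv_twoCurve (E : WeierstrassCurve F) [E.IsElliptic] (h2F : (2 : F) ≠ 0)
    {T : (E.baseChange Ω).toAffine.Point} (hT : T + T = 0) {x₀ y₀ : F} {h₀}
    (hT₀ : T = .some (algebraMap F Ω x₀) (algebraMap F Ω y₀) h₀) :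
    ∃ (a₀ b₀ : F) (a b : Ω) (_ : algebraMap F Ω a₀ = a) (_ : algebraMap F Ω b₀ = b)
      (_ : (twoCurve a₀ b₀).IsElliptic) (_ : (twoCurve a b).IsElliptic)
      (ι : (E.baseChange Ω).toAffine.Point ≃+ (twoCurve a b).toAffine.Point),
      IsIsogenyOver F
        (ι : (E.baseChange Ω).toAffine.Point →+ (twoCurve a b).toAffine.Point) ∧
      IsIsogenyOver F
        (ι.symm : (twoCurve a b).toAffine.Point →+ (E.baseChange Ω).toAffine.Point) ∧
      ι T = twoPoint _ _ := by
  -- moves `T` to the origin and makes `a₁` vanish; then `a₃ = 0` and `a₆ = 0` since `2 T = 0`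
  let C : VariableChange F := ⟨1, x₀, -E.a₁ / 2, y₀⟩
  have hinj := (algebraMap F Ω).injective
  have hE : E.toAffine.Equation x₀ y₀ :=
    (map_equation (W := E.toAffine) hinj x₀ y₀).mp h₀.1
  have hy : 2 * y₀ + E.a₁ * x₀ + E.a₃ = 0 := by
    have h := eq_neg_of_add_eq_zero_left hT
    rw [hT₀, Point.neg_some, Point.some.injEq] at h
    have h' : algebraMap F Ω (2 * y₀ + E.a₁ * x₀ + E.a₃) = 0 := by
      have := h.2
      have e₁ : (E.baseChange Ω).a₁ = algebraMap F Ω E.a₁ := rfl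
      have e₃ : (E.baseChange Ω).a₃ = algebraMap F Ω E.a₃ := rfl
      simp only [negY] at this
      simp only [map_add, map_mul, map_ofNat]
      linear_combination this - algebraMap F Ω x₀ * e₁ - e₃
    exact (map_eq_zero _).mp h'
  rw [equation_iff'] at hE
  have hC : C • E = twoCurve (C • E).a₂ (C • E).a₄ := by
    ext
    · simp only [variableChange_a₁, C, twoCurve]
      field_simp
      simp
    · rfl
    · simp only [variableChange_a₃, C, twoCurve]
      simp only [inv_one, Units.val_one, one_pow, one_mul]
      linear_combination hy
    · rfl
    · simp only [variableChange_a₆, C, twoCurve]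
      simp only [inv_one, Units.val_one, one_pow, one_mul]
      linear_combination -hE
  have hell : (twoCurve (C • E).a₂ (C • E).a₄).IsElliptic := by
    rw [← hC]
    infer_instance
  have hC' : C.map (algebraMap F Ω) • E.baseChange Ω
      = twoCurve (algebraMap F Ω (C • E).a₂) (algebraMap F Ω (C • E).a₄) := by
    change C.map (algebraMap F Ω) • E.map (algebraMap F Ω) = _
    rw [map_variableChange]
    conv_lhs => rw [hC]
    rw [map_twoCurve]
  have hell' : (twoCurve (algebraMap F Ω (C • E).a₂) (algebraMap F Ω (C • E).a₄)).IsElliptic := by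
    rw [← map_twoCurve]
    infer_instance
  obtain ⟨ι, hι, hι', hform⟩ := exists_addEquiv_of_variableChange _ _ C hC'
  refine ⟨_, _, _, _, rfl, rfl, hell, hell', ι, hι, hι', ?_⟩
  obtain ⟨h', hT'⟩ := hform _ _ h₀
  rw [hT₀, hT', twoPoint, Point.mk, Point.some.injEq]
  simp [C]

/-- The quotient of an elliptic curve by a rational point `T` of order two: there are an elliptic
curve `E'` over `F`, an isogeny `π : E → E'` over `F` with kernel `{0, T}` and a dual isogeny `π'`
over `F`, such that isogenies over `F` that vanish on the kernel of `π` or `π'` factor over `F`. -/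
theorem exists_twoIsogeny (E : WeierstrassCurve F) [E.IsElliptic] (h2F : (2 : F) ≠ 0)
    {T : (E.baseChange Ω).toAffine.Point} (hT : T + T = 0) {x₀ y₀ : F} {h₀}
    (hT₀ : T = .some (algebraMap F Ω x₀) (algebraMap F Ω y₀) h₀) :
    ∃ (E' : WeierstrassCurve F) (_ : E'.IsElliptic)
      (π : (E.baseChange Ω).toAffine.Point →+ (E'.baseChange Ω).toAffine.Point)
      (π' : (E'.baseChange Ω).toAffine.Point →+ (E.baseChange Ω).toAffine.Point),
      IsIsogenyOver F π ∧ IsIsogenyOver F π' ∧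
      Function.Surjective π ∧ Function.Surjective π' ∧
      (∀ P, π P = 0 ↔ P = 0 ∨ P = T) ∧ (∃ T' ≠ 0, ∀ Q, π' Q = 0 ↔ Q = 0 ∨ Q = T') ∧
      (∀ P, π' (π P) = (2 : ℕ) • P) ∧
      (∀ (W : Affine Ω) (φ : (E.baseChange Ω).toAffine.Point →+ W.Point),
        IsIsogenyOver F φ → (∀ P, π P = 0 → φ P = 0) →
        ∃ χ : (E'.baseChange Ω).toAffine.Point →+ W.Point,
          IsIsogenyOver F χ ∧ ∀ P, χ (π P) = φ P) ∧
      (∀ (W : Affine Ω) (φ : (E'.baseChange Ω).toAffine.Point →+ W.Point),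
        IsIsogenyOver F φ → (∀ P, π' P = 0 → φ P = 0) →
        ∃ χ : (E.baseChange Ω).toAffine.Point →+ W.Point,
          IsIsogenyOver F χ ∧ ∀ P, χ (π' P) = φ P) := by
  obtain ⟨a₀, b₀, a, b, ha, hb, hell₀, hell, ι, hι, hι', hιT⟩ :=
    exists_addEquiv_twoCurve E h2F hT hT₀
  have hmap : (twoCurve (-2 * a₀) (a₀ ^ 2 - 4 * b₀)).baseChange Ω
      = twoCurve (-2 * a) (a ^ 2 - 4 * b) := by
    change (twoCurve _ _).map (algebraMap F Ω) = _
    rw [map_twoCurve]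
    simp [ha, hb, map_ofNat]
  obtain ⟨ρ, hρ, hρ', hdual⟩ := exists_dual_twoIsog a b h2F
  refine ⟨twoCurve (-2 * a₀) (a₀ ^ 2 - 4 * b₀), inferInstance, ?_⟩
  rw [hmap]
  have hπ := isIsogenyOver_twoIsog a b b₀ hb
  have hb' : algebraMap F Ω (a₀ ^ 2 - 4 * b₀) = a ^ 2 - 4 * b := by simp [ha, hb, map_ofNat]
  have ha' : algebraMap F Ω (-2 * a₀) = -2 * a := by simp [ha, map_ofNat]
  have hπ' := isIsogenyOver_twoIsog (-2 * a) (a ^ 2 - 4 * b) (a₀ ^ 2 - 4 * b₀) hb'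
  refine ⟨(twoIsog a b).comp ι,
    ((ι.symm : (twoCurve a b).toAffine.Point →+ (E.baseChange Ω).toAffine.Point).comp
      (ρ : _ →+ (twoCurve a b).toAffine.Point)).comp (twoIsog (-2 * a) (a ^ 2 - 4 * b)),
    hπ.comp hι, (hι'.comp hρ).comp hπ', ?_, ?_, ?_, ⟨twoPoint _ _, twoPoint_ne_zero _ _, ?_⟩,
    ?_, ?_, ?_⟩
  · exact (twoIsog_surjective a b).comp ι.surjective
  · exact (ι.symm.surjective.comp ρ.surjective).comp (twoIsog_surjective _ _)
  · intro P
    simp only [AddMonoidHom.comp_apply, AddMonoidHom.coe_coe, twoIsog_eq_zero_iff]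
    rw [← hιT, ι.injective.eq_iff, map_eq_zero_iff ι ι.injective]
  · intro Q
    simp [twoIsog_eq_zero_iff]
  · intro P
    simp [hdual]
  · intro W φ hφ h0
    obtain ⟨χ, hχ, hχ'⟩ := exists_factor_twoIsog a b a₀ b₀ ha hb (hφ.comp hι') (by
      rw [← hιT]
      simp only [AddMonoidHom.comp_apply, AddMonoidHom.coe_coe, AddEquiv.symm_apply_apply]
      exact h0 T (by simp [hιT, twoIsog_twoPoint]))
    refine ⟨χ, hχ, fun P ↦ ?_⟩
    simpa using DFunLike.congr_fun hχ' (ι P)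
  · intro W φ hφ h0
    obtain ⟨χ, hχ, hχ'⟩ := exists_factor_twoIsog _ _ _ _ ha' hb' hφ
      (h0 _ (by simp [twoIsog_twoPoint]))
    refine ⟨(χ.comp (ρ.symm : (twoCurve a b).toAffine.Point →+
      (twoCurve (-2 * (-2 * a)) ((-2 * a) ^ 2 - 4 * (a ^ 2 - 4 * b))).toAffine.Point)).comp ι,
      (hχ.comp hρ').comp hι, fun P ↦ ?_⟩
    simpa using DFunLike.congr_fun hχ' P

end Quotient

end WeierstrassCurve.Affine

/-! ### Finite cyclic groups -/

section CyclicGroup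

variable {G : Type*} [AddCommGroup G] {A : AddSubgroup G}

/-- In a finite cyclic group, an element whose order divides that of `x` is a multiple of `x`. -/
lemma IsAddCyclic.mem_zmultiples_of_addOrderOf_dvd [Finite A] (hA : IsAddCyclic A) {x y : G}
    (hx : x ∈ A) (hy : y ∈ A) (h : addOrderOf y ∣ addOrderOf x) : y ∈ AddSubgroup.zmultiples x := by
  classical
  have := Fintype.ofFinite A
  let x' : A := ⟨x, hx⟩
  let y' : A := ⟨y, hy⟩
  have hox : addOrderOf x' = addOrderOf x := AddSubgroup.addOrderOf_mk x hx
  have hoy : addOrderOf y' = addOrderOf y := AddSubgroup.addOrderOf_mk y hy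
  have hpos : 0 < addOrderOf x' := addOrderOf_pos x'
  have hle := IsAddCyclic.card_nsmul_eq_zero_le (α := A) hpos
  have hsub : (AddSubgroup.zmultiples x' : Set A).toFinset ⊆
      Finset.univ.filter fun b : A ↦ addOrderOf x' • b = 0 := by
    intro b hb
    obtain ⟨k, rfl⟩ : b ∈ AddSubgroup.zmultiples x' := by simpa using hb
    simp [smul_comm _ k, addOrderOf_nsmul_eq_zero]
  have hcard : (AddSubgroup.zmultiples x' : Set A).toFinset.card = addOrderOf x' := by
    rw [Set.toFinset_card, ← Nat.card_eq_fintype_card]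
    exact Nat.card_zmultiples x'
  have heq := Finset.eq_of_subset_of_card_le hsub (by rw [hcard]; exact hle)
  have hy' : y' ∈ (AddSubgroup.zmultiples x' : Set A).toFinset := by
    rw [heq]
    simpa using addOrderOf_dvd_iff_nsmul_eq_zero.mp (hox ▸ hoy ▸ h)
  obtain ⟨k, hk⟩ : y' ∈ AddSubgroup.zmultiples x' := by simpa using hy'
  exact ⟨k, congr_arg Subtype.val hk⟩

lemma IsAddCyclic.exists_addOrderOf_eq [Finite A] (hA : IsAddCyclic A) {d : ℕ}
    (hd : d ∣ Nat.card A) : ∃ x ∈ A, addOrderOf x = d := by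
  obtain ⟨g, hg⟩ := IsAddCyclic.exists_ofOrder_eq_natCard (α := A)
  obtain ⟨e, he⟩ := hd
  have hpos : 0 < Nat.card A := Nat.card_pos
  refine ⟨(e • g : A), (e • g).2, ?_⟩
  have he0 : e ≠ 0 := by
    rintro rfl
    omega
  rw [AddSubgroup.addOrderOf_coe, addOrderOf_nsmul' g he0, hg, he, Nat.gcd_mul_left_left]
  exact Nat.mul_div_cancel _ (Nat.pos_of_ne_zero he0)

/-- A finite cyclic group has at most one element of order two. -/
lemma IsAddCyclic.eq_of_two_nsmul [Finite A] (hA : IsAddCyclic A) {x y : G} (hx : x ∈ A)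
    (hy : y ∈ A) (hx0 : x ≠ 0) (hy0 : y ≠ 0) (hx2 : 2 • x = 0) (hy2 : 2 • y = 0) : x = y := by
  obtain ⟨k, hk⟩ := hA.mem_zmultiples_of_addOrderOf_dvd hy hx
    (by rw [addOrderOf_eq_prime hx2 hx0, addOrderOf_eq_prime hy2 hy0])
  have hy2' : (2 : ℤ) • y = 0 := by exact_mod_cast hy2
  change k • y = x at hk
  rcases Int.even_or_odd' k with ⟨j, rfl | rfl⟩
  · rw [mul_comm, mul_smul, hy2', smul_zero] at hk
    exact (hx0 hk.symm).elim
  · rw [add_smul, mul_comm, mul_smul, hy2', smul_zero, zero_add, one_smul] at hk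
    exact hk.symm

/-- In a finite cyclic group, an element of order `2 ^ i` is divisible by two if `2 ^ (i + 1)`
divides the order of the group. -/
lemma IsAddCyclic.mem_map_two [Finite A] (hA : IsAddCyclic A) {x : G} (hx : x ∈ A) {i : ℕ}
    (hi : addOrderOf x = 2 ^ i) (hd : 2 ^ (i + 1) ∣ Nat.card A) :
    x ∈ A.map (nsmulAddMonoidHom 2 : G →+ G) := by
  obtain ⟨y, hy, hoy⟩ := hA.exists_addOrderOf_eq hd
  have h2 : addOrderOf (2 • y) = 2 ^ i := by
    rw [addOrderOf_nsmul' y two_ne_zero, hoy, pow_succ, Nat.gcd_mul_left_left]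
    simp
  obtain ⟨k, hk⟩ := hA.mem_zmultiples_of_addOrderOf_dvd (A.nsmul_mem hy 2) hx
    (by rw [hi, h2])
  refine ⟨k • y, A.zsmul_mem hy k, ?_⟩
  rw [← hk]
  exact smul_comm 2 k y

lemma AddSubgroup.card_map_mul_two {G H : Type*} [AddCommGroup G] [AddCommGroup H]
    (A : AddSubgroup G) (f : G →+ H) {c : G} (hc : c ≠ 0)
    (h : ∀ x ∈ A, f x = 0 ↔ x = 0 ∨ x = c) (hcA : c ∈ A) :
    Nat.card (A.map f) * 2 = Nat.card A := by
  have hker : Nat.card (f.comp A.subtype).ker = 2 := by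
    have : ((f.comp A.subtype).ker : Set A) = {0, ⟨c, hcA⟩} := by
      ext ⟨x, hx⟩
      simp [AddMonoidHom.mem_ker, h x hx]
    have hcard : ((f.comp A.subtype).ker : Set A).ncard = 2 := by
      rw [this]
      exact Set.ncard_pair fun h ↦ hc (congr_arg Subtype.val h).symm
    exact hcard
  have hr : (f.comp A.subtype).range = A.map f := by
    rw [AddMonoidHom.range_comp, AddSubgroup.range_subtype]
  rw [← AddSubgroup.card_mul_index (f.comp A.subtype).ker, hker, AddSubgroup.index_ker, hr,
    mul_comm]

lemma IsAddCyclic.map {G H : Type*} [AddCommGroup G] [AddCommGroup H] {A : AddSubgroup G}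
    (hA : IsAddCyclic A) (f : G →+ H) : IsAddCyclic (A.map f) :=
  isAddCyclic_of_surjective (f.addSubgroupMap A) (f.addSubgroupMap_surjective A)

end CyclicGroup

/-! ### Two-power torsion in two-divisible groups -/

section TwoDivisible

variable {G G' H H' : Type*} [AddCommGroup G] [AddCommGroup G'] [AddCommGroup H] [AddCommGroup H']

/-- A point of order a power of two. -/
def IsTwoPowTorsion (x : G) : Prop := ∃ j : ℕ, 2 ^ j • x = 0

lemma IsTwoPowTorsion.map {x : G} (hx : IsTwoPowTorsion x) (f : G →+ H) :
    IsTwoPowTorsion (f x) := by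
  obtain ⟨j, hj⟩ := hx
  exact ⟨j, by rw [← map_nsmul, hj, map_zero]⟩

lemma IsTwoPowTorsion.eq_zero_of_odd {x : G} (hx : IsTwoPowTorsion x) {u : ℤ} (hu : Odd u)
    (h : u • x = 0) : x = 0 := by
  obtain ⟨j, hj⟩ := hx
  obtain ⟨t, rfl⟩ := hu
  have hcop : IsCoprime (2 * t + 1) (2 : ℤ) := ⟨1, -t, by ring⟩
  obtain ⟨r, s, hrs⟩ := hcop.pow_right (n := j)
  have hj' : (2 ^ j : ℤ) • x = 0 := by exact_mod_cast hj
  rw [← one_smul ℤ x, ← hrs, add_smul, mul_smul, mul_smul, h, hj', smul_zero, smul_zero, add_zero]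

lemma exists_two_pow_nsmul_eq (hdiv : ∀ x : G, ∃ y, 2 • y = x) (r : ℕ) (x : G) :
    ∃ y, 2 ^ r • y = x := by
  induction r with
  | zero => exact ⟨x, by simp⟩
  | succ r ih =>
    obtain ⟨y, rfl⟩ := ih
    obtain ⟨z, rfl⟩ := hdiv y
    exact ⟨z, by rw [pow_succ, mul_smul]⟩

lemma exists_isTwoPowTorsion (hdiv : ∀ x : G, ∃ y, 2 • y = x) (r : ℕ) {x : G}
    (hx : IsTwoPowTorsion x) : ∃ y, IsTwoPowTorsion y ∧ 2 ^ r • y = x := by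
  obtain ⟨y, rfl⟩ := exists_two_pow_nsmul_eq hdiv r x
  obtain ⟨j, hj⟩ := hx
  exact ⟨y, ⟨j + r, by rw [pow_add, mul_smul, hj]⟩, rfl⟩

lemma eq_zero_of_two_pow_smul (hdiv : ∀ x : G, ∃ y, 2 • y = x) (r : ℕ) (h : G →+ H)
    (h0 : ∀ x, IsTwoPowTorsion x → 2 ^ r • h x = 0) (x : G) (hx : IsTwoPowTorsion x) :
    h x = 0 := by
  obtain ⟨y, hy, rfl⟩ := exists_isTwoPowTorsion hdiv r hx
  rw [map_nsmul, h0 y hy]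

/-- The `2`-power torsion of a `2`-divisible group has no nontrivial finite quotient, so a
homomorphism `h` with `f ∘ h = 0` there vanishes if `f` has finite kernel. -/
lemma eq_zero_of_comp_eq_zero (hdiv : ∀ x : G, ∃ y, 2 • y = x) (h : G →+ H) (f : H →+ H')
    [Finite f.ker] (h0 : ∀ x, IsTwoPowTorsion x → f (h x) = 0) (x : G)
    (hx : IsTwoPowTorsion x) : h x = 0 := by
  obtain ⟨r, u, hu, hru⟩ := Nat.exists_eq_two_pow_mul_odd (Nat.card_pos (α := f.ker)).ne'
  obtain ⟨y, hy, rfl⟩ := exists_isTwoPowTorsion hdiv r hx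
  have hN : Nat.card f.ker • h y = 0 := by
    have := card_nsmul_eq_zero' (G := f.ker) (x := ⟨h y, h0 y hy⟩)
    exact congr_arg Subtype.val this
  refine (hx.map h).eq_zero_of_odd (u := u) (by exact_mod_cast hu) ?_
  rw [map_nsmul, natCast_zsmul, ← mul_smul, mul_comm, ← hru, hN]

end TwoDivisible

/-! ### Homomorphisms with kernel of order two -/

section DegreeTwo

variable {G G' H H' : Type*} [AddCommGroup G] [AddCommGroup G'] [AddCommGroup H] [AddCommGroup H']

lemma two_nsmul_eq_zero_of_ker {π : G →+ G'} {c : G} (hc : c ≠ 0)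
    (hπ : ∀ x, π x = 0 ↔ x = 0 ∨ x = c) : 2 • c = 0 := by
  have h : π (2 • c) = 0 := by rw [map_nsmul, (hπ c).mpr (Or.inr rfl), smul_zero]
  rcases (hπ _).mp h with h | h
  · exact h
  · rw [two_nsmul, add_eq_left] at h
    exact (hc h).elim

lemma two_nsmul_eq_zero_of_map {π : G →+ G'} {c x : G} (hc : c ≠ 0)
    (hπ : ∀ x, π x = 0 ↔ x = 0 ∨ x = c) (h : π x = 0) : 2 • x = 0 := by
  rcases (hπ _).mp h with rfl | rfl
  · exact smul_zero 2
  · exact two_nsmul_eq_zero_of_ker hc hπ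

lemma IsTwoPowTorsion.of_map {π : G →+ G'} {c x : G} (hc : c ≠ 0)
    (hπ : ∀ x, π x = 0 ↔ x = 0 ∨ x = c) (h : IsTwoPowTorsion (π x)) : IsTwoPowTorsion x := by
  obtain ⟨j, hj⟩ := h
  rw [← map_nsmul] at hj
  exact ⟨j + 1, by rw [pow_succ', mul_smul, two_nsmul_eq_zero_of_map hc hπ hj]⟩

/-- Dividing by the multiple `c` of order two halves the order. -/
lemma addOrderOf_map_of_ker {π : G →+ G'} {c x : G} (hc : c ≠ 0)
    (hπ : ∀ x, π x = 0 ↔ x = 0 ∨ x = c) {j : ℕ} (ho : addOrderOf x = 2 ^ (j + 1))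
    (hx : 2 ^ j • x = c) : addOrderOf (π x) = 2 ^ j := by
  refine Nat.dvd_antisymm (addOrderOf_dvd_of_nsmul_eq_zero ?_) ?_
  · rw [← map_nsmul, hx]
    exact (hπ c).mpr (Or.inr rfl)
  · have h : π (addOrderOf (π x) • x) = 0 := by rw [map_nsmul, addOrderOf_nsmul_eq_zero]
    have h2 := two_nsmul_eq_zero_of_map hc hπ h
    rw [← mul_smul] at h2
    have := addOrderOf_dvd_of_nsmul_eq_zero h2
    rw [ho, pow_succ'] at this
    exact Nat.dvd_of_mul_dvd_mul_left two_pos this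

/-- The `2`-torsion is not cyclic, so it is not contained in a cyclic kernel. -/
lemma not_isTwoPowTorsion_le_ker {π : G →+ G'} {π' : G' →+ G} {c : G} {c' : G'} (hc : c ≠ 0)
    (hc' : c' ≠ 0) (hπ : ∀ x, π x = 0 ↔ x = 0 ∨ x = c) (hπ' : ∀ x, π' x = 0 ↔ x = 0 ∨ x = c')
    (hsurj : Function.Surjective π) (hdual : ∀ x, π' (π x) = 2 • x) (f : G →+ H) [Finite f.ker]
    (hf : IsAddCyclic f.ker) (h0 : ∀ x, IsTwoPowTorsion x → f x = 0) : False := by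
  obtain ⟨d, hd⟩ := hsurj c'
  have hd2 : 2 • d = 0 := by
    rw [← hdual, hd]
    exact (hπ' c').mpr (Or.inr rfl)
  have hd0 : d ≠ 0 := by
    rintro rfl
    exact hc' (by rw [← hd, map_zero])
  have hc2 := two_nsmul_eq_zero_of_ker hc hπ
  have hcd : c = d := hf.eq_of_two_nsmul (h0 c ⟨1, by simpa using hc2⟩)
    (h0 d ⟨1, by simpa using hd2⟩) hc hd0 hc2 hd2
  exact hc' (by rw [← hd, ← hcd, (hπ c).mpr (Or.inr rfl)])

/-- If `f` and `f'` have cyclic kernels of the same even order `n` and `π` has degree two, then the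
`2`-part of the kernel of `f' ∘ π` is too large for the kernel of `f`: otherwise it would have to be
cyclic of twice the order. -/
lemma not_ker_comp_le_ker {π : G →+ G'} {c : G} (hc : c ≠ 0)
    (hπ : ∀ x, π x = 0 ↔ x = 0 ∨ x = c) (hsurj : Function.Surjective π) (f : G →+ H) (f' : G' →+ H')
    {n : ℕ} (hn : 0 < n) (hn2 : 2 ∣ n) (hf : IsAddCyclic f.ker) (hfn : Nat.card f.ker = n)
    (hf' : IsAddCyclic f'.ker) (hfn' : Nat.card f'.ker = n)
    (h : ∀ x, IsTwoPowTorsion x → f' (π x) = 0 → f x = 0) : False := by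
  have : Finite f.ker := Nat.finite_of_card_ne_zero (by omega)
  have : Finite f'.ker := Nat.finite_of_card_ne_zero (by omega)
  obtain ⟨a, n', hodd, rfl⟩ := Nat.exists_eq_two_pow_mul_odd hn.ne'
  obtain ⟨a, rfl⟩ : ∃ b, a = b + 1 := by
    refine Nat.exists_eq_succ_of_ne_zero ?_
    rintro rfl
    rw [pow_zero, one_mul] at hn2
    exact Nat.not_even_iff_odd.mpr hodd (even_iff_two_dvd.mpr hn2)
  have hc2 := two_nsmul_eq_zero_of_ker hc hπ
  have hπc := (hπ c).mpr (Or.inr rfl)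
  obtain ⟨y, hy, hoy⟩ := hf'.exists_addOrderOf_eq (d := 2 ^ (a + 1)) (by rw [hfn']; simp)
  obtain ⟨x, rfl⟩ := hsurj y
  have hy0 : 2 ^ (a + 1) • π x = 0 := by rw [← hoy, addOrderOf_nsmul_eq_zero]
  have hx : IsTwoPowTorsion x := IsTwoPowTorsion.of_map hc hπ ⟨a + 1, hy0⟩
  have hfx : f x = 0 := h x hx hy
  have hfc : f c = 0 := h c ⟨1, by simpa using hc2⟩ (by rw [hπc, map_zero])
  rw [← map_nsmul] at hy0
  rcases (hπ _).mp hy0 with h0 | h0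
  · have hne : 2 ^ a • x ≠ 0 := by
      intro h1
      have : 2 ^ (a + 1) ∣ 2 ^ a := by
        rw [← hoy]
        exact addOrderOf_dvd_of_nsmul_eq_zero (by rw [← map_nsmul, h1, map_zero])
      exact absurd ((Nat.pow_dvd_pow_iff_le_right one_lt_two).mp this) (by omega)
    have hceq : 2 ^ a • x = c := hf.eq_of_two_nsmul (f.ker.nsmul_mem hfx _) hfc hne hc
      (by rw [← mul_smul, ← pow_succ', h0]) hc2
    have : 2 ^ (a + 1) ∣ 2 ^ a := by
      rw [← hoy]
      exact addOrderOf_dvd_of_nsmul_eq_zero (by rw [← map_nsmul, hceq, hπc])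
    exact absurd ((Nat.pow_dvd_pow_iff_le_right one_lt_two).mp this) (by omega)
  · have hox : addOrderOf x = 2 ^ (a + 1 + 1) :=
      addOrderOf_eq_prime_pow (by rw [h0]; exact hc) (by rw [pow_succ', mul_smul, h0, hc2])
    have hdvd : addOrderOf x ∣ 2 ^ (a + 1) * n' := by
      rw [← hfn]
      exact f.ker.addOrderOf_dvd_natCard hfx
    rw [hox, pow_succ 2 (a + 1)] at hdvd
    exact Nat.not_even_iff_odd.mpr hodd
      (even_iff_two_dvd.mpr (Nat.dvd_of_mul_dvd_mul_left (by positivity) hdvd))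

end DegreeTwo

/-! ### The incompatibility of the kernels -/

section Configuration

variable {G G' : Type*} [AddCommGroup G] [AddCommGroup G']

lemma Int.exists_eq_two_pow_mul_odd {z : ℤ} (hz : z ≠ 0) :
    ∃ (v : ℕ) (u : ℤ), Odd u ∧ z = 2 ^ v * u := by
  obtain ⟨v, u, hu, h⟩ := Nat.exists_eq_two_pow_mul_odd (Int.natAbs_ne_zero.mpr hz)
  rcases Int.natAbs_eq z with h' | h'
  · exact ⟨v, u, by exact_mod_cast hu, by rw [h', h]; push_cast; ring⟩
  · exact ⟨v, -u, (by exact_mod_cast hu : Odd (u : ℤ)).neg, by rw [h', h]; push_cast; ring⟩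

/-- Let `π : G → G'` have degree two with dual `π'`, let `Φ` and `Φ'` be endomorphisms of `G`
and `G'` with cyclic kernels of the same even order, and suppose that, up to an automorphism
`g`, both `Φ ∘ Φ` and `Φ ∘ π' ∘ Φ' ∘ π` are multiplications by integers. Then `π` intertwines
`Φ` and `Φ'` on the `2`-power torsion, up to odd integers: every other ratio of the two integers
is excluded by the sizes of the kernels. -/
lemma exists_odd_intertwining (hdiv : ∀ x : G, ∃ y, 2 • y = x) {π : G →+ G'} {π' : G' →+ G}
    {c : G} {c' : G'} (hc : c ≠ 0) (hc' : c' ≠ 0) (hπ : ∀ x, π x = 0 ↔ x = 0 ∨ x = c)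
    (hπ' : ∀ x, π' x = 0 ↔ x = 0 ∨ x = c') (hsurj : Function.Surjective π)
    (hsurj' : Function.Surjective π') (hdual : ∀ x, π' (π x) = 2 • x)
    (Φ : G →+ G) (Φ' : G' →+ G') (g : G ≃+ G) {n : ℕ} (hn : 0 < n) (hn2 : 2 ∣ n)
    (hΦ : IsAddCyclic Φ.ker) (hΦn : Nat.card Φ.ker = n) (hΦ' : IsAddCyclic Φ'.ker)
    (hΦn' : Nat.card Φ'.ker = n) {z w : ℤ} (hz : ∀ x, g (Φ (Φ x)) = z • x)
    (hw : ∀ x, g (Φ (π' (Φ' (π x)))) = w • x) :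
    ∃ u u' : ℤ, Odd u ∧ Odd u' ∧
      ∀ x, IsTwoPowTorsion x → u • Φ' (π x) = u' • π (Φ x) := by
  have : Finite Φ.ker := Nat.finite_of_card_ne_zero (by omega)
  have : Finite Φ'.ker := Nat.finite_of_card_ne_zero (by omega)
  have hfin : Finite π'.ker := by
    refine Set.Finite.to_subtype ((Set.toFinite {0, c'}).subset fun x hx ↦ ?_)
    exact (hπ' x).mp hx
  have hdual' : ∀ y, π (π' y) = 2 • y := by
    intro y
    obtain ⟨x, rfl⟩ := hsurj y
    rw [hdual, map_nsmul]
  have hdiv' : ∀ y : G', ∃ y', 2 • y' = y := by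
    intro y
    obtain ⟨x, rfl⟩ := hsurj y
    obtain ⟨x', rfl⟩ := hdiv x
    exact ⟨π x', by rw [map_nsmul]⟩
  have hz0 : z ≠ 0 := by
    rintro rfl
    refine not_isTwoPowTorsion_le_ker hc hc' hπ hπ' hsurj hdual Φ hΦ
      (eq_zero_of_comp_eq_zero hdiv Φ Φ fun x _ ↦ ?_)
    have := hz x
    rwa [zero_smul, map_eq_zero_iff g g.injective] at this
  have hw0 : w ≠ 0 := by
    rintro rfl
    have h₁ : ∀ x, IsTwoPowTorsion x → π' (Φ' (π x)) = 0 :=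
      eq_zero_of_comp_eq_zero hdiv (π'.comp (Φ'.comp π)) Φ fun x _ ↦ by
        have := hw x
        rwa [zero_smul, map_eq_zero_iff g g.injective] at this
    have h₂ : ∀ x, IsTwoPowTorsion x → Φ' (π x) = 0 :=
      eq_zero_of_comp_eq_zero hdiv (Φ'.comp π) π' h₁
    refine not_isTwoPowTorsion_le_ker hc' hc hπ' hπ hsurj' hdual' Φ' hΦ' fun y hy ↦ ?_
    obtain ⟨x, rfl⟩ := hsurj y
    exact h₂ x (.of_map hc hπ hy)
  have hzw : ∀ x, IsTwoPowTorsion x → z • π' (Φ' (π x)) - w • Φ x = 0 :=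
    eq_zero_of_comp_eq_zero hdiv (z • π'.comp (Φ'.comp π) - w • Φ) Φ fun x _ ↦ by
      refine g.injective ?_
      simp only [AddMonoidHom.sub_apply, AddMonoidHom.smul_apply, AddMonoidHom.comp_apply, map_sub,
        map_zsmul, hz, hw, map_zero]
      rw [smul_comm, sub_self]
  obtain ⟨v, u, hu, rfl⟩ := Int.exists_eq_two_pow_mul_odd hz0
  obtain ⟨v', u', hu', rfl⟩ := Int.exists_eq_two_pow_mul_odd hw0
  rcases le_or_gt v' v with hv | hv
  · exfalso
    obtain ⟨e, rfl⟩ := Nat.exists_eq_add_of_le hv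
    have h₁ : ∀ x, IsTwoPowTorsion x → (2 ^ e * u) • π' (Φ' (π x)) - u' • Φ x = 0 :=
      eq_zero_of_two_pow_smul hdiv v' ((2 ^ e * u) • π'.comp (Φ'.comp π) - u' • Φ) fun x hx ↦ by
        rw [← hzw x hx]
        simp only [AddMonoidHom.sub_apply, AddMonoidHom.smul_apply, AddMonoidHom.comp_apply]
        module
    refine not_ker_comp_le_ker hc hπ hsurj Φ Φ' hn hn2 hΦ hΦn hΦ' hΦn' fun x hx h0 ↦ ?_
    refine (hx.map Φ).eq_zero_of_odd hu' ?_
    have := h₁ x hx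
    rwa [h0, map_zero, smul_zero, zero_sub, neg_eq_zero] at this
  · obtain ⟨e, rfl⟩ := Nat.exists_eq_add_of_lt hv
    have h₁ : ∀ x, IsTwoPowTorsion x → π' (u • Φ' (π x) - (2 ^ e * u') • π (Φ x)) = 0 :=
      eq_zero_of_two_pow_smul hdiv v (π'.comp (u • Φ'.comp π - (2 ^ e * u') • π.comp Φ))
        fun x hx ↦ by
          rw [← hzw x hx]
          simp only [AddMonoidHom.sub_apply, AddMonoidHom.smul_apply, AddMonoidHom.comp_apply,
            map_sub, map_zsmul, hdual]
          module
    have h₂ : ∀ x, IsTwoPowTorsion x → u • Φ' (π x) - (2 ^ e * u') • π (Φ x) = 0 :=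
      eq_zero_of_comp_eq_zero hdiv (u • Φ'.comp π - (2 ^ e * u') • π.comp Φ) π' h₁
    rcases Nat.eq_zero_or_pos e with rfl | he
    · refine ⟨u, u', hu, hu', fun x hx ↦ ?_⟩
      have := h₂ x hx
      rwa [pow_zero, one_mul, sub_eq_zero] at this
    · exfalso
      obtain ⟨e, rfl⟩ := Nat.exists_eq_add_of_lt he
      refine not_ker_comp_le_ker hc' hπ' hsurj' Φ' Φ hn hn2 hΦ' hΦn' hΦ hΦn fun y hy h0 ↦ ?_
      refine (hy.map Φ').eq_zero_of_odd hu ?_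
      obtain ⟨x, rfl⟩ := hsurj y
      rw [sub_eq_zero.mp (h₂ x (.of_map hc hπ hy)), zero_add, pow_succ, mul_assoc, mul_smul,
        mul_comm, mul_smul]
      rw [hdual, map_nsmul] at h0
      have h0' : (2 : ℤ) • Φ x = 0 := by exact_mod_cast h0
      rw [← map_zsmul, h0', map_zero, smul_zero, smul_zero]

/-- The configuration of kernels in the theorem is impossible when the two composite
endomorphisms are multiplications by integers. If `2 ^ k` is the exact power of two dividing
`n`, then `Φ` has to fix the point `c` of order two, although `Φ ∘ Φ` kills it; otherwise the
cyclic kernels of `Φ` and `Φ'` are linked by `π`, so that the kernel of `Φ` meets `C` in too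
large a group. -/
theorem not_scalar_of_card_inter (hdiv : ∀ x : G, ∃ y, 2 • y = x) {π : G →+ G'} {π' : G' →+ G}
    {c : G} {c' : G'} (hc : c ≠ 0) (hc' : c' ≠ 0) (hπ : ∀ x, π x = 0 ↔ x = 0 ∨ x = c)
    (hπ' : ∀ x, π' x = 0 ↔ x = 0 ∨ x = c') (hsurj : Function.Surjective π)
    (hsurj' : Function.Surjective π') (hdual : ∀ x, π' (π x) = 2 • x)
    (Φ : G →+ G) (Φ' : G' →+ G') (g : G ≃+ G) {m n k : ℕ} (hm : 0 < m) (hn : 0 < n) (hk : 0 < k)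
    (hkn : 2 ^ k ∣ n) (hΦ : IsAddCyclic Φ.ker) (hΦn : Nat.card Φ.ker = n)
    (hΦ' : IsAddCyclic Φ'.ker) (hΦn' : Nat.card Φ'.ker = n) {z w : ℤ}
    (hz : ∀ x, g (Φ (Φ x)) = z • x) (hw : ∀ x, g (Φ (π' (Φ' (π x)))) = w • x)
    (C : AddSubgroup G) (hC : IsAddCyclic C) (hCn : Nat.card C = 2 ^ m * n) (hcC : c ∈ C)
    (hI : Nat.card (Φ.ker ⊓ C.map (nsmulAddMonoidHom 2) : AddSubgroup G) = n / 2 ^ k)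
    (hI' : Nat.card (Φ'.ker ⊓ C.map π : AddSubgroup G') = n / 2 ^ k) : False := by
  have hn2 : 2 ∣ n := (dvd_pow_self 2 hk.ne').trans hkn
  obtain ⟨u, u', hu, hu', hint⟩ := exists_odd_intertwining hdiv hc hc' hπ hπ' hsurj hsurj' hdual
    Φ Φ' g hn hn2 hΦ hΦn hΦ' hΦn' hz hw
  have : Finite Φ.ker := Nat.finite_of_card_ne_zero (by omega)
  have : Finite Φ'.ker := Nat.finite_of_card_ne_zero (by omega)
  have : Finite C := Nat.finite_of_card_ne_zero (by rw [hCn]; positivity)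
  have hc2 := two_nsmul_eq_zero_of_ker hc hπ
  have hπc := (hπ c).mpr (Or.inr rfl)
  have hcT : IsTwoPowTorsion c := ⟨1, by simpa using hc2⟩
  obtain ⟨n', rfl⟩ := hkn
  have hdivn : 2 ^ k * n' / 2 ^ k = n' := Nat.mul_div_cancel_left _ (by positivity)
  rw [hdivn] at hI hI'
  -- a nontrivial intersection contains the only point `c` of order two in `C`
  have hceq : ∀ x ∈ C, addOrderOf x = 2 → x = c := by
    intro x hx ho
    refine hC.eq_of_two_nsmul hx hcC ?_ hc ?_ hc2
    · rintro rfl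
      simp at ho
    · rw [← ho, addOrderOf_nsmul_eq_zero]
  rcases Nat.even_or_odd n' with he | ho
  · have hcΦ : Φ c = 0 := by
      have : Finite (Φ.ker ⊓ C.map (nsmulAddMonoidHom 2) : AddSubgroup G) :=
        Finite.Set.finite_inter_of_left _ _
      obtain ⟨x, hx⟩ := exists_prime_addOrderOf_dvd_card' (p := 2)
        (G := (Φ.ker ⊓ C.map (nsmulAddMonoidHom 2) : AddSubgroup G)) (by
          rw [hI]
          exact he.two_dvd)
      rw [← AddSubgroup.addOrderOf_coe] at hx
      obtain ⟨hx₁, y, hy, hyx⟩ := x.2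
      rw [← hceq x (hyx ▸ C.nsmul_mem hy 2) hx]
      exact hx₁
    have hn'0 : n' ≠ 0 := by
      rintro rfl
      simp at hn
    obtain ⟨b, q, hq, rfl⟩ := Nat.exists_eq_two_pow_mul_odd hn'0
    obtain ⟨b, rfl⟩ : ∃ d, b = d + 1 := by
      refine Nat.exists_eq_succ_of_ne_zero ?_
      rintro rfl
      rw [pow_zero, one_mul] at he
      exact Nat.not_even_iff_odd.mpr hq he
    -- `x` generates the subgroup of order `2 ^ (b + 2)` of `C`, the first not contained in `ker Φ`
    obtain ⟨x, hx, hox⟩ := hC.exists_addOrderOf_eq (d := 2 ^ (b + 1 + 1)) (by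
      rw [hCn, pow_succ 2 (b + 1), mul_comm _ 2, ← mul_assoc]
      exact Nat.mul_dvd_mul ((dvd_pow_self 2 hm.ne').trans (dvd_mul_right _ _))
        (dvd_mul_right _ _))
    have hxmem : x ∈ C.map (nsmulAddMonoidHom 2) := hC.mem_map_two hx hox (by
      rw [hCn]
      calc 2 ^ (b + 1 + 1 + 1) = 2 ^ 1 * (2 ^ 1 * 2 ^ (b + 1)) := by ring
        _ ∣ 2 ^ m * (2 ^ k * (2 ^ (b + 1) * q)) := mul_dvd_mul (pow_dvd_pow 2 hm)
          (mul_dvd_mul (pow_dvd_pow 2 hk) (dvd_mul_right _ _)))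
    have hhalf : ∀ (y : G) (j : ℕ), addOrderOf y = 2 ^ (j + 1) → addOrderOf (2 ^ j • y) = 2 := by
      intro y j hy
      rw [addOrderOf_nsmul' y (by positivity), hy, pow_succ, Nat.gcd_mul_right_left,
        Nat.mul_div_cancel_left _ (by positivity)]
    have hπx : addOrderOf (π x) = 2 ^ (b + 1) := addOrderOf_map_of_ker hc hπ hox
      (hceq _ (C.nsmul_mem hx _) (hhalf _ _ hox))
    have hπC : IsAddCyclic (C.map π) := hC.map π
    have hπxΦ' : Φ' (π x) = 0 := by
      have hIc : IsAddCyclic (Φ'.ker ⊓ C.map π : AddSubgroup G') :=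
        isAddCyclic_of_injective (AddSubgroup.inclusion inf_le_left)
          (AddSubgroup.inclusion_injective inf_le_left)
      have : Finite (Φ'.ker ⊓ C.map π : AddSubgroup G') := Finite.Set.finite_inter_of_left _ _
      have : Finite (C.map π) := Set.Finite.to_subtype ((Set.toFinite (C : Set G)).image π)
      obtain ⟨y, ⟨hy, hyC⟩, hoy⟩ := hIc.exists_addOrderOf_eq (d := 2 ^ (b + 1)) (by
        rw [hI']
        exact dvd_mul_right _ _)
      obtain ⟨r, hr⟩ := hπC.mem_zmultiples_of_addOrderOf_dvd hyC ⟨x, hx, rfl⟩ (by rw [hoy, hπx])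
      rw [← hr]
      exact Φ'.ker.zsmul_mem hy r
    -- `α` generates the `2`-part of `ker Φ`
    obtain ⟨a, ha⟩ : ∃ a, k + (b + 1) = a + 1 := ⟨k + b, by ring⟩
    obtain ⟨α, hα, hoα⟩ := hΦ.exists_addOrderOf_eq (d := 2 ^ (a + 1)) (by
      rw [hΦn, ← mul_assoc, ← pow_add, ha]
      exact dvd_mul_right _ _)
    have hαT : IsTwoPowTorsion α := ⟨a + 1, by rw [← hoα, addOrderOf_nsmul_eq_zero]⟩
    have hαc : 2 ^ a • α = c := by
      have h2 := hhalf α a hoα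
      refine hΦ.eq_of_two_nsmul (Φ.ker.nsmul_mem hα _) hcΦ ?_ hc ?_ hc2
      · intro h
        rw [h] at h2
        simp at h2
      · have := addOrderOf_nsmul_eq_zero (2 ^ a • α)
        rwa [h2] at this
    have hπα : addOrderOf (π α) = 2 ^ a := addOrderOf_map_of_ker hc hπ hoα hαc
    have hπαΦ' : Φ' (π α) = 0 := by
      refine ((hαT.map π).map Φ').eq_zero_of_odd hu ?_
      rw [hint α hαT, show Φ α = 0 from hα, map_zero, smul_zero]
    obtain ⟨r, hr⟩ := hΦ'.mem_zmultiples_of_addOrderOf_dvd hπαΦ' hπxΦ' (by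
      rw [hπα, hπx]
      exact pow_dvd_pow 2 (by omega))
    have hxα : Φ (x - r • α) = 0 := by
      have : π (x - r • α) = 0 := by
        rw [map_sub, map_zsmul]
        exact sub_eq_zero.mpr hr.symm
      rcases (hπ _).mp this with h | h
      · rw [h, map_zero]
      · rw [h, hcΦ]
    have hxΦ : Φ x = 0 := by
      rwa [map_sub, map_zsmul, show Φ α = 0 from hα, smul_zero, sub_zero] at hxα
    have hdvd : addOrderOf x ∣ 2 ^ (b + 1) * q := by
      rw [← hI]
      exact AddSubgroup.addOrderOf_dvd_natCard _ ⟨hxΦ, hxmem⟩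
    rw [hox, pow_succ 2 (b + 1)] at hdvd
    exact Nat.not_even_iff_odd.mpr hq
      (even_iff_two_dvd.mpr (Nat.dvd_of_mul_dvd_mul_left (by positivity) hdvd))
  · have hoc : addOrderOf c = 2 := addOrderOf_eq_prime hc2 hc
    have hcmem : c ∈ C.map (nsmulAddMonoidHom 2) := hC.mem_map_two (i := 1) hcC (by simpa using hoc)
      (by
        rw [hCn, pow_add, ← mul_assoc]
        exact (Nat.mul_dvd_mul (pow_dvd_pow 2 hm) (pow_dvd_pow 2 hk)).trans (dvd_mul_right _ _))
    have hcΦ : Φ c ≠ 0 := by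
      intro h0
      have hdvd : addOrderOf c ∣ n' := by
        rw [← hI]
        exact AddSubgroup.addOrderOf_dvd_natCard _ ⟨h0, hcmem⟩
      rw [hoc] at hdvd
      exact Nat.not_even_iff_odd.mpr ho (even_iff_two_dvd.mpr hdvd)
    have hπΦ : π (Φ c) = 0 := by
      refine ((hcT.map Φ).map π).eq_zero_of_odd hu' ?_
      rw [← hint c hcT, hπc, map_zero, smul_zero]
    have hfix : Φ c = c := ((hπ _).mp hπΦ).resolve_left hcΦ
    obtain ⟨α, hα, hoα⟩ := hΦ.exists_addOrderOf_eq (d := 2) (by rw [hΦn]; exact hn2)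
    have hα2 : (2 : ℤ) • α = 0 := by
      have : 2 • α = 0 := by rw [← hoα, addOrderOf_nsmul_eq_zero]
      exact_mod_cast this
    have hzα : z • α = 0 := by
      rw [← hz, show Φ α = 0 from hα, map_zero, map_zero]
    obtain ⟨s, rfl⟩ : Even z := by
      by_contra h
      have := IsTwoPowTorsion.eq_zero_of_odd ⟨1, by exact_mod_cast hα2⟩
        (Int.not_even_iff_odd.mp h) hzα
      rw [this] at hoα
      simp at hoα
    have hgc := hz c
    have hc2' : (2 : ℤ) • c = 0 := by exact_mod_cast hc2
    rw [hfix, hfix, ← two_mul, mul_comm, mul_smul, hc2', smul_zero,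
      map_eq_zero_iff g g.injective] at hgc
    exact hc hgc

end Configuration

namespace WeierstrassCurve.Affine

/-! ### Galois action and halving of cyclic isogenies -/

section Galois

variable {K : Type*} [Field K]

lemma map_geomCurve (E : WeierstrassCurve K) (τ : AlgebraicClosure K ≃ₐ[K] AlgebraicClosure K) :
    (geomCurve E).map ((τ : AlgebraicClosure K ≃+* AlgebraicClosure K) :
      AlgebraicClosure K →+* AlgebraicClosure K) = geomCurve E := by
  change (E.map _).map _ = E.map _
  rw [map_map]
  congr 1
  ext x
  simp

variable [DecidableEq (AlgebraicClosure K)]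

/-- The action of the absolute Galois group on the geometric points. -/
noncomputable def galois (E : WeierstrassCurve K)
    (τ : AlgebraicClosure K ≃ₐ[K] AlgebraicClosure K) :
    (geomCurve E).Point ≃+ (geomCurve E).Point :=
  pointCongr (τ : AlgebraicClosure K ≃+* AlgebraicClosure K) (map_geomCurve E τ)

lemma galois_equivariant {E E' : WeierstrassCurve K} [E.IsElliptic]
    {φ : (geomCurve E).Point →+ (geomCurve E').Point} (hφ : IsIsogenyOver K φ)
    (τ : AlgebraicClosure K ≃ₐ[K] AlgebraicClosure K) (P : (geomCurve E).Point) :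
    φ (galois E τ P) = galois E' τ (φ P) :=
  hφ.map_pointCongr τ _ _ P

/-- A nonzero point fixed by the absolute Galois group has coordinates in `K`. -/
lemma exists_rational_of_galois [CharZero K] (E : WeierstrassCurve K) {T : (geomCurve E).Point}
    (hT : T ≠ 0) (h : ∀ τ, galois E τ T = T) :
    ∃ (x₀ y₀ : K) (h₀ : (geomCurve E).Nonsingular (algebraMap K (AlgebraicClosure K) x₀)
      (algebraMap K (AlgebraicClosure K) y₀)), T = .some _ _ h₀ := by
  rcases T with _ | ⟨x, y, hxy⟩
  · exact (hT rfl).elim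
  have hx : ∀ τ : AlgebraicClosure K ≃ₐ[K] AlgebraicClosure K, τ x = x := fun τ ↦
    (Point.some.inj (h τ)).1
  have hy : ∀ τ : AlgebraicClosure K ≃ₐ[K] AlgebraicClosure K, τ y = y := fun τ ↦
    (Point.some.inj (h τ)).2
  obtain ⟨x₀, rfl⟩ := (InfiniteGalois.mem_range_algebraMap_iff_fixed x).mpr hx
  obtain ⟨y₀, rfl⟩ := (InfiniteGalois.mem_range_algebraMap_iff_fixed y).mpr hy
  exact ⟨x₀, y₀, hxy, rfl⟩

/-- From a cyclic isogeny `ψ` over `K` of even degree `2 N`, with `c` the point of order two in its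
kernel `C`, one obtains the `2`-isogeny `π` with kernel `{0, c}` and its dual `π'`, and two cyclic
isogenies of degree `N` over `K`: one from `E` with kernel `2 C`, one from `E / c` with kernel
`C / c`. -/
theorem exists_half_isogenies [CharZero K] {E E₁ : WeierstrassCurve K} [E.IsElliptic]
    [E₁.IsElliptic] {N : ℕ} (hN : 0 < N) {ψ : (geomCurve E).Point →+ (geomCurve E₁).Point}
    (hψ : IsCyclicIsogenyOver K (2 * N) ψ) :
    ∃ (E' : WeierstrassCurve K) (_ : E'.IsElliptic)
      (π : (geomCurve E).Point →+ (geomCurve E').Point)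
      (π' : (geomCurve E').Point →+ (geomCurve E).Point) (c : (geomCurve E).Point)
      (c' : (geomCurve E').Point),
      IsIsogenyOver K π ∧ IsIsogenyOver K π' ∧ Function.Surjective π ∧ Function.Surjective π' ∧
      c ≠ 0 ∧ c' ≠ 0 ∧ (∀ P, π P = 0 ↔ P = 0 ∨ P = c) ∧ (∀ Q, π' Q = 0 ↔ Q = 0 ∨ Q = c') ∧
      (∀ P, π' (π P) = (2 : ℕ) • P) ∧ c ∈ ψ.ker ∧
      (∃ (E₂ : WeierstrassCurve K) (_ : E₂.IsElliptic)
        (χ : (geomCurve E).Point →+ (geomCurve E₂).Point),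
        IsCyclicIsogenyOver K N χ ∧ χ.ker = ψ.ker.map (nsmulAddMonoidHom 2)) ∧
      ∃ χ : (geomCurve E').Point →+ (geomCurve E₁).Point,
        IsCyclicIsogenyOver K N χ ∧ χ.ker = ψ.ker.map π := by
  obtain ⟨hψi, hψc, hψN⟩ := hψ
  have : Finite ψ.ker := Nat.finite_of_card_ne_zero (by omega)
  have h2K : (2 : K) ≠ 0 := two_ne_zero
  obtain ⟨c, hc, hoc⟩ := hψc.exists_addOrderOf_eq (d := 2) (by rw [hψN]; exact dvd_mul_right 2 N)
  have hc2 : (2 : ℕ) • c = 0 := by rw [← hoc, addOrderOf_nsmul_eq_zero]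
  have hc0 : c ≠ 0 := by
    rintro rfl
    simp at hoc
  -- uniqueness makes the point of order two in the kernel rational
  have hcgal : ∀ τ, galois E τ c = c := by
    intro τ
    refine hψc.eq_of_two_nsmul ?_ hc ?_ hc0 ?_ hc2
    · rw [AddMonoidHom.mem_ker, galois_equivariant hψi, show ψ c = 0 from hc, map_zero]
    · exact (map_ne_zero_iff _ (galois E τ).injective).mpr hc0
    · rw [← map_nsmul, hc2, map_zero]
  obtain ⟨x₀, y₀, h₀, hcxy⟩ := exists_rational_of_galois E hc0 hcgal
  obtain ⟨E', hE', π, π', hπ, hπ', hsurj, hsurj', hker, ⟨c', hc'0, hker'⟩, hdual, hfac, hfac'⟩ :=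
    exists_twoIsogeny E h2K (by rw [← two_nsmul, hc2]) hcxy
  refine ⟨E', hE', π, π', c, c', hπ, hπ', hsurj, hsurj', hc0, hc'0, hker, hker', hdual, hc, ?_, ?_⟩
  · obtain ⟨d, hd⟩ := hsurj c'
    have hd2 : (2 : ℕ) • d = 0 := by
      rw [← hdual, hd]
      exact (hker' c').mpr (Or.inr rfl)
    have hd0 : d ≠ 0 := by
      rintro rfl
      exact hc'0 (by rw [← hd, map_zero])
    have hψd : ψ d ≠ 0 := by
      intro h
      have hdc : d = c := hψc.eq_of_two_nsmul h hc hd0 hc0 hd2 hc2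
      exact hc'0 (by rw [← hd, hdc, (hker c).mpr (Or.inr rfl)])
    -- the image of the `2`-torsion of `E` has order two, hence is rational
    have htors : ∀ x, (2 : ℕ) • x = 0 → ψ x = 0 ∨ ψ x = ψ d := by
      intro x hx
      rw [← hdual] at hx
      rcases (hker' _).mp hx with h | h
      · rcases (hker x).mp h with rfl | rfl
        · exact Or.inl (map_zero _)
        · exact Or.inl hc
      · rw [← hd, ← sub_eq_zero, ← map_sub] at h
        right
        rw [← sub_eq_zero, ← map_sub]
        rcases (hker _).mp h with h | h
        · rw [h, map_zero]
        · rw [h]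
          exact hc
    have hdgal : ∀ τ, galois E₁ τ (ψ d) = ψ d := by
      intro τ
      rw [← galois_equivariant hψi]
      refine (htors _ (by rw [← map_nsmul, hd2, map_zero])).resolve_left ?_
      rw [galois_equivariant hψi]
      exact (map_ne_zero_iff _ (galois E₁ τ).injective).mpr hψd
    obtain ⟨x₁, y₁, h₁, hdxy⟩ := exists_rational_of_galois E₁ hψd hdgal
    obtain ⟨E₂, hE₂, ρ, -, hρ, -, -, -, hρker, -, -, -, -⟩ := exists_twoIsogeny E₁ h2K
      (by rw [← map_add, ← two_nsmul, hd2, map_zero]) hdxy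
    obtain ⟨χ₁, hχ₁, hχ₁π⟩ := hfac _ (ρ.comp ψ) (hρ.comp hψi) (fun P hP ↦ by
      rcases (hker P).mp hP with rfl | rfl
      · exact map_zero _
      · rw [AddMonoidHom.comp_apply, show ψ P = 0 from hc, map_zero])
    obtain ⟨χ, hχ, hχπ'⟩ := hfac' _ χ₁ hχ₁ (fun Q hQ ↦ by
      obtain ⟨P, rfl⟩ := hsurj Q
      rw [hdual] at hQ
      rw [hχ₁π]
      exact (hρker _).mpr (htors P hQ))
    have hχ2 : ∀ P, χ ((2 : ℕ) • P) = ρ (ψ P) := by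
      intro P
      rw [← hdual, hχπ', hχ₁π]
      rfl
    have hχker : χ.ker = ψ.ker.map (nsmulAddMonoidHom 2) := by
      ext x
      constructor
      · intro hx
        obtain ⟨Q, rfl⟩ := hsurj' x
        obtain ⟨P, rfl⟩ := hsurj Q
        rw [hdual, AddMonoidHom.mem_ker, hχ2, hρker] at hx
        rw [hdual]
        rcases hx with h | h
        · exact ⟨P, h, rfl⟩
        · refine ⟨P - d, ?_, ?_⟩
          · change ψ (P - d) = 0
            rw [map_sub, h, sub_self]
          · change (2 : ℕ) • (P - d) = (2 : ℕ) • P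
            rw [smul_sub, hd2, sub_zero]
      · rintro ⟨P, hP, rfl⟩
        change χ ((2 : ℕ) • P) = 0
        rw [hχ2, show ψ P = 0 from hP, map_zero]
    refine ⟨E₂, hE₂, χ, ⟨hχ, ?_, ?_⟩, hχker⟩
    · rw [hχker]
      exact hψc.map _
    · rw [hχker]
      have := ψ.ker.card_map_mul_two (nsmulAddMonoidHom 2) hc0 (fun x hx ↦ ⟨fun h ↦ ?_, ?_⟩) hc
      · omega
      · by_cases hx0 : x = 0
        · exact Or.inl hx0
        · exact Or.inr (hψc.eq_of_two_nsmul hx hc hx0 hc0 h hc2)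
      · rintro (rfl | rfl)
        · exact map_zero _
        · exact hc2
  · obtain ⟨χ, hχ, hχπ⟩ := hfac _ ψ hψi (fun P hP ↦ by
      rcases (hker P).mp hP with rfl | rfl
      · exact map_zero _
      · exact hc)
    have hχker : χ.ker = ψ.ker.map π := by
      ext x
      constructor
      · intro hx
        obtain ⟨P, rfl⟩ := hsurj x
        exact ⟨P, by rwa [AddMonoidHom.mem_ker, hχπ] at hx, rfl⟩
      · rintro ⟨P, hP, rfl⟩
        rw [AddMonoidHom.mem_ker, hχπ]
        exact hP
    refine ⟨χ, ⟨hχ, ?_, ?_⟩, hχker⟩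
    · rw [hχker]
      exact hψc.map _
    · rw [hχker]
      have := ψ.ker.card_map_mul_two π hc0 (fun x _ ↦ hker x) hc
      rw [hψN, mul_comm 2 N] at this
      exact Nat.eq_of_mul_eq_mul_right two_pos this

end Galois

/-! ### Conjugate curves -/

section Conjugate

variable {K : Type*} [Field K]

/-- An extension of an automorphism of `K` to the algebraic closure. -/
noncomputable def closureLift (σ : K ≃+* K) : AlgebraicClosure K ≃+* AlgebraicClosure K :=
  IsAlgClosure.equivOfEquiv (AlgebraicClosure K) (AlgebraicClosure K) σ

lemma map_closureLift (σ : K ≃+* K) (E : WeierstrassCurve K) :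
    (geomCurve E).map (closureLift σ : AlgebraicClosure K →+* AlgebraicClosure K)
      = geomCurve (E.map (σ : K →+* K)) := by
  change (E.map _).map _ = (E.map _).map _
  rw [map_map, map_map]
  congr 1
  exact IsAlgClosure.equivOfEquiv_comp_algebraMap _ _ σ

/-- An isogeny to a twist of the conjugate curve becomes an isogeny to the conjugate curve over the
algebraic closure, with the same kernel. -/
lemma exists_isogeny_of_isTwist [DecidableEq (AlgebraicClosure K)] {E E₂ E₃ : WeierstrassCurve K}
    [E₂.IsElliptic] (h : IsTwist E₂ E₃) {φ : (geomCurve E).Point →+ (geomCurve E₂).Point}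
    (hφ : IsIsogenyOver K φ) :
    ∃ φ' : (geomCurve E).Point →+ (geomCurve E₃).Point,
      IsIsogenyOver (AlgebraicClosure K) φ' ∧ φ'.ker = φ.ker := by
  obtain ⟨C, hC⟩ := h
  obtain ⟨ι, hι, -, -⟩ := exists_addEquiv_of_variableChange (geomCurve E₂) (geomCurve E₃) C
    (F := AlgebraicClosure K) (by rw [← hC]; rfl)
  refine ⟨(ι : (geomCurve E₂).Point →+ (geomCurve E₃).Point).comp φ,
    hι.comp (hφ.mono (AlgebraicClosure K)), ?_⟩
  ext P
  simp [AddMonoidHom.mem_ker]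

end Conjugate

end WeierstrassCurve.Affine

open WeierstrassCurve.Affine in
open scoped Classical in
theorem mainTheorem5 {K : Type*} [Field K] [NumberField K] (hK : Module.finrank ℚ K = 2)
    (σ : K ≃ₐ[ℚ] K) (hσ : σ ≠ 1)
    (m n k : ℕ) (hm : 0 < m) (hn : 0 < n) (hk : 0 < k) (hkn : 2 ^ k ∣ n)
    (h : ∀ (E E₁ : WeierstrassCurve K) [E.IsElliptic] [E₁.IsElliptic]
      (ψ : (geomCurve E).Point →+ (geomCurve E₁).Point),
      IsCyclicIsogenyOver K (2 ^ (m - 1) * n) ψ →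
      ∃ (E₂ : WeierstrassCurve K) (_ : E₂.IsElliptic)
        (φ : (geomCurve E).Point →+ (geomCurve E₂).Point),
        IsTwist E₂ (E.map (σ : K →+* K)) ∧
        IsCyclicIsogenyOver K n φ ∧
        Nat.card (φ.ker ⊓ ψ.ker : AddSubgroup (geomCurve E).Point) = n / 2 ^ k)
    (E : WeierstrassCurve K) [E.IsElliptic] (hE : HasCyclicIsogeny E (2 ^ m * n)) :
    HasCM E := by
  by_contra hCM
  have hscalar : ∀ φ : (geomCurve E).Point →+ (geomCurve E).Point,
      IsIsogenyOver (AlgebraicClosure K) φ → ∃ z : ℤ, ∀ P, φ P = z • P := by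
    intro φ hφ
    by_contra hz
    refine hCM ⟨φ, hφ, fun z ↦ ?_⟩
    by_contra hz'
    exact hz ⟨z, fun P ↦ by_contra fun hP ↦ hz' ⟨P, hP⟩⟩
  obtain ⟨E₁, hE₁, ψ, hψ⟩ := hE
  -- the hypothesis is applied to the curve `E` and the kernel `2 C`, and to `E / c` and `C / c`
  have hpow : 2 ^ m * n = 2 * (2 ^ (m - 1) * n) := by
    rw [← mul_assoc, ← pow_succ', Nat.sub_add_cancel hm]
  obtain ⟨E', hE', π, π', c, c', hπ, hπ', hsurj, hsurj', hc, hc', hker, hker', hdual, hcψ,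
    ⟨E₂, hE₂, χ, hχ, hχker⟩, χ', hχ', hχker'⟩ :=
    exists_half_isogenies (N := 2 ^ (m - 1) * n) (by positivity) (hpow ▸ hψ)
  obtain ⟨E₃, hE₃, φ, htw, ⟨hφ, hφc, hφn⟩, hI⟩ := h E E₂ χ hχ
  obtain ⟨E₄, hE₄, φ', htw', ⟨hφ', hφc', hφn'⟩, hI'⟩ := h E' E₁ χ' hχ'
  obtain ⟨α, hα, hαker⟩ := exists_isogeny_of_isTwist htw hφ
  obtain ⟨α', hα', hαker'⟩ := exists_isogeny_of_isTwist htw' hφ'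
  have hσσ : ∀ x, σ (σ x) = x := by
    have hle := AlgEquiv.card_le (F := ℚ) (K := K)
    rw [hK] at hle
    have h2 : Fintype.card (K ≃ₐ[ℚ] K) = 2 :=
      le_antisymm hle (Fintype.one_lt_card_iff.mpr ⟨σ, 1, hσ⟩)
    have hpow2 : σ ^ 2 = 1 := h2 ▸ pow_card_eq_one
    intro x
    have := DFunLike.congr_fun hpow2 x
    simpa [pow_two] using this
  -- `e` extends `σ`; applied to coordinates it gives `s : E → E^σ`, `t : E^σ → E` and
  -- `s' : E' → E'^σ`
  let e := closureLift (σ : K ≃+* K)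
  have hs : (geomCurve E).map (e : AlgebraicClosure K →+* AlgebraicClosure K)
      = geomCurve (E.map (σ : K →+* K)) := map_closureLift (σ : K ≃+* K) E
  have hs' : (geomCurve E').map (e : AlgebraicClosure K →+* AlgebraicClosure K)
      = geomCurve (E'.map (σ : K →+* K)) := map_closureLift (σ : K ≃+* K) E'
  have ht : (geomCurve (E.map (σ : K →+* K))).map
      (e : AlgebraicClosure K →+* AlgebraicClosure K) = geomCurve E := by
    refine (map_closureLift (σ : K ≃+* K) (E.map (σ : K →+* K))).trans ?_
    rw [WeierstrassCurve.map_map]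
    have : ((σ : K ≃+* K) : K →+* K).comp (σ : K →+* K) = RingHom.id K := by
      ext x
      exact hσσ x
    rw [this, WeierstrassCurve.map_id]
  let s := pointCongr e hs
  let s' := pointCongr e hs'
  let t := pointCongr e ht
  let Φ : (geomCurve E).Point →+ (geomCurve E).Point :=
    (s.symm : (geomCurve (E.map (σ : K →+* K))).Point →+ (geomCurve E).Point).comp α
  let Φ' : (geomCurve E').Point →+ (geomCurve E').Point :=
    (s'.symm : (geomCurve (E'.map (σ : K →+* K))).Point →+ (geomCurve E').Point).comp α'
  have hΦker : Φ.ker = φ.ker := by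
    rw [← hαker]
    ext P
    simp [Φ, AddMonoidHom.mem_ker]
  have hΦker' : Φ'.ker = φ'.ker := by
    rw [← hαker']
    ext P
    simp [Φ', AddMonoidHom.mem_ker]
  have hconj := hα.conj e hs ht
  have hconj' := (hπ'.mono (AlgebraicClosure K)).conj e hs' hs
  -- `Φ ∘ Φ` and `Φ ∘ π' ∘ Φ' ∘ π`, followed by `s` and `t`, are isogenies over the algebraic
  -- closure, hence integers in the absence of CM
  obtain ⟨z, hz⟩ := hscalar _ (hconj.comp hα)
  obtain ⟨w, hw⟩ := hscalar _ ((hconj.comp hconj').comp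
    (hα'.comp (hπ.mono (AlgebraicClosure K))))
  have hdiv : ∀ x : (geomCurve E).Point, ∃ y, 2 • y = x := by
    intro x
    obtain ⟨Q, rfl⟩ := hsurj' x
    obtain ⟨P, rfl⟩ := hsurj Q
    exact ⟨P, (hdual P).symm⟩
  refine not_scalar_of_card_inter hdiv hc hc' hker hker' hsurj hsurj' hdual Φ Φ' (s.trans t) hm hn
    hk hkn (hΦker ▸ hφc) (hΦker ▸ hφn) (hΦker' ▸ hφc') (hΦker' ▸ hφn') (z := z) (w := w) ?_ ?_
    ψ.ker hψ.2.1 hψ.2.2 hcψ ?_ ?_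
  · intro x
    rw [← hz x]
    simp [Φ, s, t]
  · intro x
    rw [← hw x]
    simp [Φ, Φ', s, s', t]
  · rw [hΦker, ← hχker]
    exact hI
  · rw [hΦker', ← hχker']
    exact hI'
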